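/- **Setting.** Let $d\in\mathbb N$, let $\mu_1,\mu_{-1},\nu_1,\nu_{-1}\in\mathbb R^d$ be nonzero and mutually orthogonal with $\|\mu_1\|=\|\mu_{-1}\|=:\|\mu\|$ and $\|\nu_1\|=\|\nu_{-1}\|=:\|\nu\|$, let $p_e,p_h,p_b>0$ with $p_e+p_h+p_b=1$, and $\sigma_p>0$. The distribution $\mathcal D$ of $(X,y)$, $X=(x^{(1)},x^{(2)},x^{(3)})\in(\mathbb R^d)^3$, $y\in\{\pm1\}$, is: $y$ is uniform; the signal pair is $(\mu_y,\mu_y)$ with probability $p_e$ (easy-only), uniform on $\{(\pm\nu_y,\pm\nu_y)\}$ (four sign choices) with probability $p_h$ (hard-only), and uniform on $\{(\mu_y,\pm\nu_y),(\pm\nu_y,\mu_y)\}$ with probability $p_b$ (both-signal); the noise $\xi\sim\mathcal N(0,\sigma_p^2\Lambda)$ is independent, where $\Lambda$ is the orthogonal projection onto the orthogonal complement of the four signals; the patches of $X$ are the two signal vectors and $\xi$ in uniformly random order. $\mathcal S_e,\mathcal S_b$ are the supports of the easy-only and the both-signal data. The weak model is $f(w,X)=\sum_{p=1}^3\langle w,x^{(p)}\rangle$.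 Given i.i.d. $(X_i,y_i)\sim\mathcal D$, $i\le n_{wk}$, put $L(w)=\frac1{n_{wk}}\sum_i\log(1+e^{-y_if(w,X_i)})$, and let $w^{(0)}=0$, $w^{(t+1)}=w^{(t)}-\eta\nabla L(w^{(t)})$. Further parameters are $n_{st},m\in\mathbb N$, $\sigma_0,\eta,\varepsilon>0$, $\delta\in(0,1)$ and a real $T^*\ge2$ (the maximal number of iterations). For $C>0$, condition $(\mathrm{DS}_C)$ (data-scarce regime) says that all of the following hold: * $d\ge C\max\{n_{wk}^2\log(Cn_{wk}^2/\delta),\,n_{st}\log(Cn_{st}/\delta)\}(\log T^*)^2$; * $n_{wk},n_{st}\ge C\max\{p_e^{-2},p_b^{-2},p_h^{-2}\}\log(C/\delta)$ and $m\ge C\log(Cn_{st}/\delta)$; * $\sigma_0\le C^{-1}\min\{\frac1{\|\mu\|},\frac1{\|\nu\|},\frac1{\sigma_p\sqrt d}\}\min\{\frac{n_{st}p_b\|\nu\|^2}{\sigma_p^2d},\frac{\sigma_p^2d}{(2p_e+p_b)n_{st}\|\mu\|^2}\}(\log(Cmn_{st}/\delta))^{-1/2}$; * $\eta\le C^{-1}\sigma_p^{-2}d^{-3/2}$;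 * $(2p_e+p_b)\|\mu\|^2\ge Cp_b\|\nu\|^2$; * $p_b\ge C\max\{p_h,\ \sigma_p\|\mu\|\|\nu\|^{-2}(\log T^*)^{1/2}\}$; * $n_{wk},n_{st}\le C^{-1}\sigma_p^2d/((2p_e+p_b)\|\mu\|^2\log T^*)$. **Theorem.** There are absolute constants $C_0,C_1,K>0$ and $k\in\mathbb N$ such that for every $C\ge C_0$: (a) For all parameters satisfying $(\mathrm{DS}_C)$, with probability at least $1-\delta$ over the training set there is an integer $T_{wk}\ge 0$ with $T_{wk}\le K\,(\log(2+1/\varepsilon))^k\,\eta^{-1}\varepsilon^{-1}n_{wk}d^{-1}\sigma_p^{-2}$ (that is, $T_{wk}=\tilde O(\eta^{-1}\varepsilon^{-1}n_{wk}d^{-1}\sigma_p^{-2})$) such that for all integers $t\in[T_{wk},T^*]$ both $L(w^{(t)})<\varepsilon$ and, for a fresh test example $(X,y)\sim\mathcal D$ independent of the training set, $$\mathbb P\big[y f(w^{(t)},X)<0\,\big|\,(X,y)\in\mathcal S_e\cup\mathcal S_b\big]\le\exp\Big(-\frac{n_{wk}(2p_e+p_b)^2\|\mu\|^4}{C_1\sigma_p^4d}\Big).$$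 (b) This bound is $o(1)$: along any family of parameters that eventually satisfies $(\mathrm{DS}_C)$ and for which $n_{wk}=\omega\big(\sigma_p^4d/((2p_e+p_b)^2\|\mu\|^4)\big)$, the right-hand side above tends to $0$. -/

import Mathlib

open MeasureTheory ProbabilityTheory Filter Topology
open scoped ENNReal Gradient

noncomputable section

/-- The ambient space `ℝ^d` of patches, with the Euclidean norm. -/
abbrev Patch (d : ℕ) : Type := EuclideanSpace ℝ (Fin d)

/-- A labelled data point `(X, y)`: three patches in `ℝ^d` and a label `y ∈ {1, -1} = ℤˣ`. -/
abbrev DataPoint (d : ℕ) : Type := (Fin 3 → Patch d) × ℤˣ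

/-- The label as a real number `±1`. -/
def labelSign (y : ℤˣ) : ℝ := ((y : ℤ) : ℝ)

/-- The weak model, a linear CNN: `f(w, X) = ⟨w, x⁽¹⁾⟩ + ⟨w, x⁽²⁾⟩ + ⟨w, x⁽³⁾⟩`. -/
def weakModel {d : ℕ} (w : Patch d) (X : Fin 3 → Patch d) : ℝ :=
  ∑ p : Fin 3, inner ℝ w (X p)

/-- The logistic loss `ℓ(z) = log (1 + exp (-z))`. -/
def logisticLoss (z : ℝ) : ℝ := Real.log (1 + Real.exp (-z))

/-- The training loss `L(w) = (1/n) ∑ i, ℓ(yᵢ f(w, Xᵢ))` of the weak model. -/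
def trainingLoss {d n : ℕ} (train : Fin n → DataPoint d) (w : Patch d) : ℝ :=
  (1 / (n : ℝ)) * ∑ i : Fin n, logisticLoss (labelSign (train i).2 * weakModel w (train i).1)

/-- The iterates of gradient descent with learning rate `η` on the training loss, started at `0`. -/
def weakIterate {d n : ℕ} (η : ℝ) (train : Fin n → DataPoint d) : ℕ → Patch d
  | 0 => 0
  | t + 1 => weakIterate η train t - η • ∇ (trainingLoss train) (weakIterate η train t)

/-- The input whose patches are `v₁, v₂, ξ` in the order prescribed by the permutation `π`. -/
def shuffledInput {d : ℕ} (v : Patch d × Patch d) (ξ : Patch d) (π : Equiv.Perm (Fin 3)) :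
    Fin 3 → Patch d :=
  fun p => (![v.1, v.2, ξ] : Fin 3 → Patch d) (π p)

/-- All the parameters of the problem. The fields `nst`, `m`, `σ₀` (sample size, width and
initialization scale of the strong model) enter only through the parameter conditions. -/
structure Setting where
  /-- dimension of the patches -/
  d : ℕ
  /-- easy signals `μ₁`, `μ₋₁` -/
  μ : ℤˣ → Patch d
  /-- hard signals `ν₁`, `ν₋₁` -/
  ν : ℤˣ → Patch d
  /-- probability of easy-only data -/
  pe : ℝ
  /-- probability of hard-only data -/
  ph : ℝ
  /-- probability of both-signal data -/
  pb : ℝ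
  /-- noise level -/
  σp : ℝ
  /-- number of training points of the weak model -/
  nwk : ℕ
  /-- number of training points of the strong model -/
  nst : ℕ
  /-- width of the strong model -/
  m : ℕ
  /-- initialization scale of the strong model -/
  σ₀ : ℝ
  /-- learning rate -/
  η : ℝ
  /-- target training loss -/
  ε : ℝ
  /-- failure probability -/
  δ : ℝ
  /-- maximal admissible number of iterations `T*` -/
  Tstar : ℝ

namespace Setting

variable (S : Setting)

/-- The common norm `‖μ‖` of the easy signals. -/
def normμ : ℝ := ‖S.μ 1‖

/-- The common norm `‖ν‖` of the hard signals. -/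
def normν : ℝ := ‖S.ν 1‖

/-- `Λ = I - ∑ μ_s μ_sᵀ / ‖μ_s‖² - ∑ ν_s ν_sᵀ / ‖ν_s‖²`. -/
def noiseCov : Matrix (Fin S.d) (Fin S.d) ℝ :=
  1 - ∑ s : ℤˣ, (‖S.μ s‖ ^ 2)⁻¹ • Matrix.vecMulVec (fun i => S.μ s i) (fun i => S.μ s i)
    - ∑ s : ℤˣ, (‖S.ν s‖ ^ 2)⁻¹ • Matrix.vecMulVec (fun i => S.ν s i) (fun i => S.ν s i)

/-- The law `N(0, σ_p² Λ)` of the noise vector. -/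
def noiseLaw : Measure (Patch S.d) :=
  multivariateGaussian 0 (S.σp ^ 2 • S.noiseCov)

/-- The only signal pair of an easy-only data point with label `y`. -/
def easyPairs (y : ℤˣ) : Fin 1 → Patch S.d × Patch S.d :=
  fun _ => (S.μ y, S.μ y)

/-- The four equally likely signal pairs of a hard-only data point with label `y`. -/
def hardPairs (y : ℤˣ) : Fin 4 → Patch S.d × Patch S.d :=
  ![(S.ν y, S.ν y), (S.ν y, -S.ν y), (-S.ν y, S.ν y), (-S.ν y, -S.ν y)]

/-- The four equally likely signal pairs of a both-signal data point with label `y`. -/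
def bothPairs (y : ℤˣ) : Fin 4 → Patch S.d × Patch S.d :=
  ![(S.μ y, S.ν y), (S.μ y, -S.ν y), (S.ν y, S.μ y), (-S.ν y, S.μ y)]

/-- Law of `(X, y)` when the label `y` is uniform on `{1, -1}`, the signal pair is uniform among
the `k` pairs listed for `y`, the order of the patches is a uniform permutation, and the noise
vector is Gaussian, all independent: the equal-weight mixture over the `2 * k * 3!` discrete
choices. -/
def typeLaw {k : ℕ} (pairs : ℤˣ → Fin k → Patch S.d × Patch S.d) : Measure (DataPoint S.d) :=
  ∑ y : ℤˣ, ∑ j : Fin k, ∑ π : Equiv.Perm (Fin 3),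
    ((2 : ℝ≥0∞) * (k : ℝ≥0∞) * 6)⁻¹ •
      S.noiseLaw.map (fun ξ : Patch S.d => (shuffledInput (pairs y j) ξ π, y))

/-- The data distribution `D`: easy-only, hard-only and both-signal data are drawn with
probabilities `p_e`, `p_h`, `p_b`. -/
def dataLaw : Measure (DataPoint S.d) :=
  ENNReal.ofReal S.pe • S.typeLaw S.easyPairs
    + ENNReal.ofReal S.ph • S.typeLaw S.hardPairs
    + ENNReal.ofReal S.pb • S.typeLaw S.bothPairs

/-- The support of a data category: the data points whose patches are, in some order, one of the
signal pairs of the category and a vector orthogonal to all the signals (such vectors form the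
support of the noise law). -/
def typeSupport {k : ℕ} (pairs : ℤˣ → Fin k → Patch S.d × Patch S.d) : Set (DataPoint S.d) :=
  {z | ∃ (j : Fin k) (π : Equiv.Perm (Fin 3)) (ξ : Patch S.d),
    (∀ s : ℤˣ, inner ℝ (S.μ s) ξ = 0 ∧ inner ℝ (S.ν s) ξ = 0) ∧
      z.1 = shuffledInput (pairs z.2 j) ξ π}

/-- The set `S_e` of easy-only data. -/
def easyData : Set (DataPoint S.d) := S.typeSupport S.easyPairs

/-- The set `S_b` of both-signal data. -/
def bothData : Set (DataPoint S.d) := S.typeSupport S.bothPairs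

/-- Law of the training set: `n_wk` i.i.d. samples of `D`. -/
def trainingLaw : Measure (Fin S.nwk → DataPoint S.d) :=
  Measure.pi (fun _ => S.dataLaw)

/-- The conditional test error `P[y f(w, X) < 0 | (X, y) ∈ S_e ∪ S_b]` of the weight vector `w`,
where `(X, y) ∼ D`. -/
def condTestError (w : Patch S.d) : ℝ≥0∞ :=
  (S.dataLaw)[{z : DataPoint S.d | labelSign z.2 * weakModel w z.1 < 0} | S.easyData ∪ S.bothData]

/-- The standing assumptions of the problem. -/
structure IsAdmissible : Prop where
  μ_ne_zero : ∀ s, S.μ s ≠ 0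
  ν_ne_zero : ∀ s, S.ν s ≠ 0
  μ_orthogonal : inner ℝ (S.μ 1) (S.μ (-1)) = 0
  ν_orthogonal : inner ℝ (S.ν 1) (S.ν (-1)) = 0
  μ_ν_orthogonal : ∀ s s', inner ℝ (S.μ s) (S.ν s') = 0
  norm_μ_eq : ‖S.μ 1‖ = ‖S.μ (-1)‖
  norm_ν_eq : ‖S.ν 1‖ = ‖S.ν (-1)‖
  pe_pos : 0 < S.pe
  ph_pos : 0 < S.ph
  pb_pos : 0 < S.pb
  p_sum : S.pe + S.ph + S.pb = 1
  σp_pos : 0 < S.σp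
  σ₀_pos : 0 < S.σ₀
  η_pos : 0 < S.η
  ε_pos : 0 < S.ε
  δ_pos : 0 < S.δ
  δ_lt_one : S.δ < 1
  two_le_Tstar : 2 ≤ S.Tstar

/-- The non-asymptotic parameter conditions with constant `C`, including the data-scarce
condition. -/
structure DataScarce (C : ℝ) : Prop extends S.IsAdmissible where
  high_dim : C * max ((S.nwk : ℝ) ^ 2 * Real.log (C * (S.nwk : ℝ) ^ 2 / S.δ))
      ((S.nst : ℝ) * Real.log (C * (S.nst : ℝ) / S.δ)) * (Real.log S.Tstar) ^ 2 ≤ (S.d : ℝ)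
  nwk_large : C * max (max (S.pe ^ 2)⁻¹ (S.pb ^ 2)⁻¹) (S.ph ^ 2)⁻¹ * Real.log (C / S.δ)
      ≤ (S.nwk : ℝ)
  nst_large : C * max (max (S.pe ^ 2)⁻¹ (S.pb ^ 2)⁻¹) (S.ph ^ 2)⁻¹ * Real.log (C / S.δ)
      ≤ (S.nst : ℝ)
  m_large : C * Real.log (C * (S.nst : ℝ) / S.δ) ≤ (S.m : ℝ)
  init_small : S.σ₀ ≤ C⁻¹
      * min (min (1 / S.normμ) (1 / S.normν)) (1 / (S.σp * Real.sqrt (S.d : ℝ)))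
      * min ((S.nst : ℝ) * S.pb * S.normν ^ 2 / (S.σp ^ 2 * (S.d : ℝ)))
          (S.σp ^ 2 * (S.d : ℝ) / ((2 * S.pe + S.pb) * (S.nst : ℝ) * S.normμ ^ 2))
      * (Real.sqrt (Real.log (C * (S.m : ℝ) * (S.nst : ℝ) / S.δ)))⁻¹
  lr_small : S.η ≤ C⁻¹ * (S.σp ^ 2)⁻¹ * (S.d : ℝ) ^ (-(3 / 2) : ℝ)
  easy_dominates : C * (S.pb * S.normν ^ 2) ≤ (2 * S.pe + S.pb) * S.normμ ^ 2
  both_large : C * max S.ph (S.σp * S.normμ * (S.normν ^ 2)⁻¹ * Real.sqrt (Real.log S.Tstar))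
      ≤ S.pb
  nwk_scarce : (S.nwk : ℝ)
      ≤ C⁻¹ * (S.σp ^ 2 * (S.d : ℝ) / ((2 * S.pe + S.pb) * S.normμ ^ 2 * Real.log S.Tstar))
  nst_scarce : (S.nst : ℝ)
      ≤ C⁻¹ * (S.σp ^ 2 * (S.d : ℝ) / ((2 * S.pe + S.pb) * S.normμ ^ 2 * Real.log S.Tstar))

/-- The sample size scale `σ_p⁴ d / ((2 p_e + p_b)² ‖μ‖⁴)`. -/
def sampleScale : ℝ :=
  S.σp ^ 4 * (S.d : ℝ) / ((2 * S.pe + S.pb) ^ 2 * S.normμ ^ 4)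

/-- The test error bound `exp (-n_wk (2 p_e + p_b)² ‖μ‖⁴ / (C₁ σ_p⁴ d))`. -/
def errorBound (C₁ : ℝ) : ℝ :=
  Real.exp (-((S.nwk : ℝ) * (2 * S.pe + S.pb) ^ 2 * S.normμ ^ 4 / (C₁ * S.σp ^ 4 * (S.d : ℝ))))

/-- The bound `K (log (2 + 1/ε))^k η⁻¹ ε⁻¹ n_wk d⁻¹ σ_p⁻²` on the number of steps, that is,
`η⁻¹ ε⁻¹ n_wk d⁻¹ σ_p⁻²` up to a constant and logarithmic factors. -/
def timeBound (K : ℝ) (k : ℕ) : ℝ :=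
  K * Real.log (2 + 1 / S.ε) ^ k * (S.η⁻¹ * S.ε⁻¹ * (S.nwk : ℝ) * (S.d : ℝ)⁻¹ * (S.σp ^ 2)⁻¹)

end Setting

end

/-! Started at 0, gradient descent stays in the span of the signed training inputs: the weight is `∑
i, a i • y i • patchSum (X i)`, and `a i` grows by `η / n` times the logistic slope at the margin of
example `i` (`weakIterate_eq_sum`). In the data-scarce regime training is memorization. The noise
vectors `ξ i` have squared norm of order `D = σp² d` and are nearly orthogonal, while all signals
together contribute only order `n (2pe + pb) ‖μ‖²`, far below `D / log T*`. So the margin of example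
`i` is `a i ‖ξ i‖²` up to an error of at most 1 (`margin_close`), and the examples decouple into
scalar recursions in which `exp (a i ‖ξ i‖²)` grows linearly in time. The approximation needs `a i
‖ξ i‖² = O(log T*)`, and linear growth up to time `T*` gives exactly this, so both are carried by
one induction (`exp_growth_bounds`).

Two consequences follow. The loss at time `t` is at most `3 / (1 + q t)` with `q = η D / (30 n)`,
hence below `ε` after order `n / (η ε D)` steps. And all `a i` lie between `lo` and `14400 lo` for a
common `lo` (`gdCoeff_comparable`). The easy signals then add up coherently to a margin of order `lo
n (2pe + pb) ‖μ‖²`, whereas the memorized noises add like orthogonal vectors, to norm of order `lo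
√(n D)`. On a fresh example carrying an easy signal the noise term is Gaussian with deviation of
order `σp lo √(n D)`. In the squared ratio `lo` cancels, which leaves the stated exponent at every
positive time (`signal_to_noise`).

All this is deterministic on the event `GoodTraining`, whose complement has probability at most `δ`
(`trainingLaw_not_good`): Gaussian tails control norms and inner products of the noises, Hoeffding's
inequality controls the signal counts. -/

/-! ### Gradient descent as a recursion on coefficients. -/

/-- The negated derivative `1 / (1 + e^z)` of the logistic loss. -/
noncomputable def logisticSlope (z : ℝ) : ℝ := 1 / (1 + Real.exp z)

lemma logisticSlope_pos (z : ℝ) : 0 < logisticSlope z := by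
  unfold logisticSlope; positivity

lemma hasDerivAt_logisticLoss (z : ℝ) : HasDerivAt logisticLoss (-logisticSlope z) z := by
  have h1 : HasDerivAt (fun z : ℝ => 1 + Real.exp (-z)) (-Real.exp (-z)) z := by
    simpa using ((hasDerivAt_neg z).exp.const_add 1)
  have h2 := h1.log (by positivity)
  refine h2.congr_deriv ?_
  simp only [logisticSlope, Real.exp_neg]
  field_simp
  ring

lemma logisticLoss_le_exp_neg (z : ℝ) : logisticLoss z ≤ Real.exp (-z) := by
  unfold logisticLoss
  have := Real.log_le_sub_one_of_pos (x := 1 + Real.exp (-z)) (by positivity)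
  linarith

/-- The sum of the three patches of an input. -/
def patchSum {d : ℕ} (X : Fin 3 → Patch d) : Patch d := ∑ p, X p

lemma weakModel_eq_inner {d : ℕ} (w : Patch d) (X : Fin 3 → Patch d) :
    weakModel w X = inner ℝ w (patchSum X) := by
  simp [weakModel, patchSum, inner_sum]

lemma hasGradientAt_trainingLoss {d n : ℕ} (train : Fin n → DataPoint d) (w : Patch d) :
    HasGradientAt (trainingLoss train)
      (-((1 / (n : ℝ)) • ∑ i, logisticSlope (labelSign (train i).2 * weakModel w (train i).1) •
        labelSign (train i).2 • patchSum (train i).1)) w := by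
  rw [hasGradientAt_iff_hasFDerivAt]
  have h1 : ∀ i : Fin n, HasFDerivAt
      (fun w => logisticLoss (labelSign (train i).2 * weakModel w (train i).1))
      ((-logisticSlope (labelSign (train i).2 * weakModel w (train i).1)) •
        (labelSign (train i).2 • (innerSL ℝ (patchSum (train i).1)))) w := by
    intro i
    have h2 : HasFDerivAt (fun w => labelSign (train i).2 * weakModel w (train i).1)
        (labelSign (train i).2 • (innerSL ℝ (patchSum (train i).1))) w := by
      have : (fun w => labelSign (train i).2 * weakModel w (train i).1)
          = fun w => labelSign (train i).2 * (innerSL ℝ (patchSum (train i).1)) w := by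
        ext w
        rw [weakModel_eq_inner, innerSL_apply_apply, real_inner_comm]
      rw [this]
      exact (innerSL ℝ (patchSum (train i).1)).hasFDerivAt.const_mul _
    exact (hasDerivAt_logisticLoss _).comp_hasFDerivAt w h2
  have h3 := (HasFDerivAt.fun_sum (u := Finset.univ) fun i _ => h1 i).const_mul (1 / (n : ℝ))
  refine h3.congr_fderiv ?_
  ext v
  simp [Finset.mul_sum, Finset.sum_neg_distrib]

/-- The coefficients of the iterates of gradient descent in the signed training inputs. -/
noncomputable def gdCoeff {d n : ℕ} (η : ℝ) (train : Fin n → DataPoint d) : ℕ → Fin n → ℝ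
  | 0 => 0
  | t + 1 => fun i => gdCoeff η train t i + η / n *
      logisticSlope (labelSign (train i).2 * weakModel (weakIterate η train t) (train i).1)

lemma weakIterate_eq_sum {d n : ℕ} (η : ℝ) (train : Fin n → DataPoint d) (t : ℕ) :
    weakIterate η train t =
      ∑ i, gdCoeff η train t i • labelSign (train i).2 • patchSum (train i).1 := by
  induction t with
  | zero => simp [weakIterate, gdCoeff]
  | succ t ih =>
    rw [weakIterate, (hasGradientAt_trainingLoss train _).gradient]
    simp only [gdCoeff, add_smul, Finset.sum_add_distrib, ← ih, smul_neg, sub_neg_eq_add]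
    congr 1
    rw [Finset.smul_sum, Finset.smul_sum]
    refine Finset.sum_congr rfl fun i _ => ?_
    simp only [smul_smul]
    congr 1
    ring

/-! ### The scalar recursion and its logarithmic growth. -/

/-- The slope at `z` is at most `exp (-z)`, which for `z ≥ x - 1` cancels the factor `exp x` up to
`e < 3`. The other factor 2 comes from `exp u ≤ 1 + 2 u` on `[0, 1]`. -/
lemma exp_step_upper {x z κ : ℝ} (hκ0 : 0 ≤ κ) (hκ : κ ≤ 1) (hz : x - 1 ≤ z) :
    Real.exp (x + κ * logisticSlope z) ≤ Real.exp x + 6 * κ := by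
  have hs1 : logisticSlope z ≤ 1 := by
    unfold logisticSlope
    rw [div_le_one (by positivity)]
    linarith [Real.exp_pos z]
  have hs0 := (logisticSlope_pos z).le
  have hu0 : 0 ≤ κ * logisticSlope z := mul_nonneg hκ0 hs0
  have hu1 : κ * logisticSlope z ≤ 1 := mul_le_one₀ hκ hs0 hs1
  have hexp : Real.exp (κ * logisticSlope z) ≤ 1 + 2 * (κ * logisticSlope z) := by
    have := Real.abs_exp_sub_one_sub_id_le (x := κ * logisticSlope z) (by rwa [abs_of_nonneg hu0])
    have := (abs_le.1 this).2
    nlinarith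
  have hs : Real.exp x * logisticSlope z ≤ Real.exp 1 := by
    have : logisticSlope z ≤ Real.exp (-z) := by
      unfold logisticSlope
      rw [Real.exp_neg, one_div]
      exact inv_anti₀ (Real.exp_pos z) (by linarith)
    calc Real.exp x * logisticSlope z ≤ Real.exp x * Real.exp (-z) := by gcongr
      _ = Real.exp (x - z) := by rw [← Real.exp_add]; ring_nf
      _ ≤ Real.exp 1 := Real.exp_le_exp.2 (by linarith)
  have he := Real.exp_one_lt_d9
  rw [Real.exp_add]
  have hx := Real.exp_pos x
  calc Real.exp x * Real.exp (κ * logisticSlope z)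
      ≤ Real.exp x * (1 + 2 * (κ * logisticSlope z)) := by gcongr
    _ = Real.exp x + 2 * κ * (Real.exp x * logisticSlope z) := by ring
    _ ≤ Real.exp x + 2 * κ * 3 := by gcongr; linarith
    _ = _ := by ring

/-- For `x ≥ 0` and `z ≤ x + 1` the slope is at least a constant times `exp (-x)`, because `1 + exp
z ≤ 6 exp x`. -/
lemma exp_step_lower {x z κ : ℝ} (hκ0 : 0 ≤ κ) (hx0 : 0 ≤ x) (hz : z ≤ x + 1) :
    Real.exp x + κ / 6 ≤ Real.exp (x + κ * logisticSlope z) := by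
  have hexp := Real.add_one_le_exp (κ * logisticSlope z)
  have he := Real.exp_one_lt_d9
  have hx := Real.exp_pos x
  have hs : 1 / 6 ≤ Real.exp x * logisticSlope z := by
    unfold logisticSlope
    have h1 : Real.exp z ≤ Real.exp x * 2.72 := by
      calc Real.exp z ≤ Real.exp (x + 1) := Real.exp_le_exp.2 hz
        _ = Real.exp x * Real.exp 1 := Real.exp_add _ _
        _ ≤ _ := by gcongr; linarith
    have h2 := Real.one_le_exp hx0
    rw [mul_one_div, div_le_div_iff₀ (by norm_num) (by positivity)]
    linarith
  rw [Real.exp_add]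
  calc Real.exp x + κ / 6 = Real.exp x + κ * (1 / 6) := by ring
    _ ≤ Real.exp x + κ * (Real.exp x * logisticSlope z) := by gcongr
    _ = Real.exp x * (κ * logisticSlope z + 1) := by ring
    _ ≤ _ := by gcongr

lemma log_one_add_six_mul_le {T : ℝ} (hT : 2 ≤ T) : Real.log (1 + 6 * T) ≤ 4 * Real.log T := by
  have h : (4 : ℝ) * Real.log T = Real.log (T ^ 4) := by rw [Real.log_pow]; norm_num
  rw [h]
  apply Real.log_le_log (by linarith)
  nlinarith [mul_self_nonneg (T ^ 2 - 4), mul_self_nonneg (T - 2)]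

/-- A bootstrap: closeness of `z t i` to `a t i * D i` is only assumed while the coefficients are
nonnegative and `a t i * D i ≤ 4 log T`. Closeness makes `exp (a t i * D i)` gain between `h D i /
6` and `6 h D i` per step, and up to time `T` this total growth restores the logarithmic bound. -/
lemma exp_growth_bounds {n : ℕ} {a z : ℕ → Fin n → ℝ} {D : Fin n → ℝ} {h T : ℝ} (hT : 2 ≤ T)
    (h0 : ∀ i, a 0 i = 0) (hh : 0 ≤ h) (hD : ∀ i, 0 < D i) (hκ : ∀ i, h * D i ≤ 1)
    (step : ∀ t i, a (t + 1) i = a t i + h * logisticSlope (z t i))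
    (hz : ∀ t, (∀ i, 0 ≤ a t i ∧ a t i * D i ≤ 4 * Real.log T) →
      ∀ i, |z t i - a t i * D i| ≤ 1) (t : ℕ) (ht : (t : ℝ) ≤ T) :
    ∀ i, 0 ≤ a t i ∧ a t i * D i ≤ 4 * Real.log T ∧
      1 + h * D i / 6 * t ≤ Real.exp (a t i * D i) ∧
      Real.exp (a t i * D i) ≤ 1 + 6 * (h * D i) * t := by
  induction t with
  | zero =>
    intro i
    have := Real.log_nonneg (x := T) (by linarith)
    simp [h0]
    exact this
  | succ t ih =>
    have ht' : (t : ℝ) ≤ T := by push_cast at ht; linarith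
    have ih := ih ht'
    intro i
    have hzi := abs_le.1 (hz t (fun i => ⟨(ih i).1, (ih i).2.1⟩) i)
    obtain ⟨ha, -, hl, hu⟩ := ih i
    have hk0 : 0 ≤ h * D i := mul_nonneg hh (hD i).le
    have e : a (t + 1) i * D i = a t i * D i + h * D i * logisticSlope (z t i) := by
      rw [step]; ring
    have up := exp_step_upper hk0 (hκ i) (x := a t i * D i) (z := z t i) (by linarith [hzi.1])
    have lo := exp_step_lower hk0 (mul_nonneg ha (hD i).le) (z := z t i) (by linarith [hzi.2])
    rw [← e] at up lo
    have hup : Real.exp (a (t + 1) i * D i) ≤ 1 + 6 * (h * D i) * (t + 1 : ℕ) := by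
      push_cast; linarith
    refine ⟨?_, ?_, ?_, hup⟩
    · rw [step]; exact add_nonneg ha (mul_nonneg hh (logisticSlope_pos _).le)
    · refine le_trans ?_ (log_one_add_six_mul_le hT)
      rw [Real.le_log_iff_exp_le (by linarith)]
      refine hup.trans ?_
      have : (h * D i) * ((t + 1 : ℕ) : ℝ) ≤ 1 * T := by
        gcongr
        exact hκ i
      linarith
    · push_cast; linarith

/-! ### Signal and noise components of a data point. -/

lemma abs_labelSign (y : ℤˣ) : |labelSign y| = 1 := by
  rcases Int.units_eq_one_or y with rfl | rfl <;> simp [labelSign]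

lemma labelSign_mul_self (y : ℤˣ) : labelSign y * labelSign y = 1 := by
  rcases Int.units_eq_one_or y with rfl | rfl <;> simp [labelSign]

namespace Setting

variable (S : Setting)

/-- The coefficient of a data point along the easy signal of its label. -/
noncomputable def easyCoeff (z : DataPoint S.d) : ℝ :=
  inner ℝ (S.μ z.2) (patchSum z.1) / S.normμ ^ 2

/-- The coefficient of a data point along the hard signal of its label. -/
noncomputable def hardCoeff (z : DataPoint S.d) : ℝ :=
  inner ℝ (S.ν z.2) (patchSum z.1) / S.normν ^ 2

/-- The noise vector of a data point. -/
noncomputable def noisePart (z : DataPoint S.d) : Patch S.d :=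
  patchSum z.1 - S.easyCoeff z • S.μ z.2 - S.hardCoeff z • S.ν z.2

/-- Orthogonality to all signals. -/
def IsNoise (ξ : Patch S.d) : Prop := ∀ s : ℤˣ, inner ℝ (S.μ s) ξ = 0 ∧ inner ℝ (S.ν s) ξ = 0

/-- The properties shared by almost all data points. -/
structure IsRegular (z : DataPoint S.d) : Prop where
  isNoise : S.IsNoise (S.noisePart z)
  easyCoeff_nonneg : 0 ≤ S.easyCoeff z
  easyCoeff_le : S.easyCoeff z ≤ 2
  abs_hardCoeff_le : |S.hardCoeff z| ≤ 2

/-- The properties of the training set on which the analysis of gradient descent relies. -/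
structure GoodTraining (θ : ℝ) (train : Fin S.nwk → DataPoint S.d) : Prop where
  regular : ∀ i, S.IsRegular (train i)
  norm_lower : ∀ i, S.σp ^ 2 * S.d / 5 ≤ ‖S.noisePart (train i)‖ ^ 2
  norm_upper : ∀ i, ‖S.noisePart (train i)‖ ^ 2 ≤ 4 * (S.σp ^ 2 * S.d)
  inner_le : ∀ i j, i ≠ j → |inner ℝ (S.noisePart (train i)) (S.noisePart (train j))| ≤ θ
  easy_upper : ∑ i, S.easyCoeff (train i) ≤ S.nwk * (2 * (2 * S.pe + S.pb))
  easy_lower : ∀ y, S.nwk * ((2 * S.pe + S.pb) / 4) ≤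
    ∑ i, if (train i).2 = y then S.easyCoeff (train i) else 0
  hard_upper : ∑ i, |S.hardCoeff (train i)| ≤ S.nwk * (3 * S.pb)

variable {S}

namespace IsAdmissible

variable (h : S.IsAdmissible)

include h

lemma norm_μ (s : ℤˣ) : ‖S.μ s‖ = S.normμ := by
  rcases Int.units_eq_one_or s with rfl | rfl
  · rfl
  · exact h.norm_μ_eq.symm

lemma norm_ν (s : ℤˣ) : ‖S.ν s‖ = S.normν := by
  rcases Int.units_eq_one_or s with rfl | rfl
  · rfl
  · exact h.norm_ν_eq.symm

lemma normμ_pos : 0 < S.normμ := norm_pos_iff.2 (h.μ_ne_zero 1)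

lemma normν_pos : 0 < S.normν := norm_pos_iff.2 (h.ν_ne_zero 1)

lemma inner_μ_self (s : ℤˣ) : inner ℝ (S.μ s) (S.μ s) = S.normμ ^ 2 := by
  rw [real_inner_self_eq_norm_sq, h.norm_μ]

lemma inner_ν_self (s : ℤˣ) : inner ℝ (S.ν s) (S.ν s) = S.normν ^ 2 := by
  rw [real_inner_self_eq_norm_sq, h.norm_ν]

lemma inner_μ_of_ne {s s' : ℤˣ} (hs : s ≠ s') : inner ℝ (S.μ s) (S.μ s') = 0 := by
  rcases Int.units_eq_one_or s with rfl | rfl <;> rcases Int.units_eq_one_or s' with rfl | rfl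
  · exact absurd rfl hs
  · exact h.μ_orthogonal
  · rw [real_inner_comm]; exact h.μ_orthogonal
  · exact absurd rfl hs

lemma inner_ν_of_ne {s s' : ℤˣ} (hs : s ≠ s') : inner ℝ (S.ν s) (S.ν s') = 0 := by
  rcases Int.units_eq_one_or s with rfl | rfl <;> rcases Int.units_eq_one_or s' with rfl | rfl
  · exact absurd rfl hs
  · exact h.ν_orthogonal
  · rw [real_inner_comm]; exact h.ν_orthogonal
  · exact absurd rfl hs

lemma inner_ν_μ (s s' : ℤˣ) : inner ℝ (S.ν s) (S.μ s') = 0 := by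
  rw [real_inner_comm]; exact h.μ_ν_orthogonal s' s

/-- Orthogonality leaves only same-label signal products and the noise product, so inputs with
different labels interact through their noise alone. -/
lemma inner_combination {ξ ξ' : Patch S.d} (hξ : S.IsNoise ξ) (hξ' : S.IsNoise ξ') (s s' : ℤˣ)
    (c b c' b' : ℝ) :
    inner ℝ (c • S.μ s + b • S.ν s + ξ) (c' • S.μ s' + b' • S.ν s' + ξ') =
      (if s = s' then c * c' * S.normμ ^ 2 + b * b' * S.normν ^ 2 else 0) + inner ℝ ξ ξ' := by
  have e1 : inner ℝ ξ (S.μ s') = 0 := by rw [real_inner_comm]; exact (hξ s').1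
  have e2 : inner ℝ ξ (S.ν s') = 0 := by rw [real_inner_comm]; exact (hξ s').2
  simp only [inner_add_left, inner_add_right, real_inner_smul_left, real_inner_smul_right,
    h.inner_ν_μ, h.μ_ν_orthogonal, e1, e2, (hξ' s).1, (hξ' s).2]
  split_ifs with hs
  · subst hs
    rw [h.inner_μ_self, h.inner_ν_self]; ring
  · rw [h.inner_μ_of_ne hs, h.inner_ν_of_ne hs]; ring

end IsAdmissible

lemma patchSum_eq (z : DataPoint S.d) :
    patchSum z.1 = S.easyCoeff z • S.μ z.2 + S.hardCoeff z • S.ν z.2 + S.noisePart z := by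
  unfold noisePart; abel

lemma isNoise_zero : S.IsNoise 0 := fun s => by simp

/-- The total noise contribution to the iterates. -/
noncomputable def noiseSum (train : Fin S.nwk → DataPoint S.d) (a : Fin S.nwk → ℝ) : Patch S.d :=
  ∑ i, a i • labelSign (train i).2 • S.noisePart (train i)

/-! ### Deterministic estimates for combinations of good training inputs. -/

namespace GoodTraining

variable {θ : ℝ} {train : Fin S.nwk → DataPoint S.d}

/-- Only the diagonal noise term is large. The remaining terms are summed over `j`: the coefficients
of example `i` are at most 2, so the totals `easy_upper` and `hard_upper` give the factors `4 = 2 *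
2` and `6 = 2 * 3`. -/
lemma margin_approx (g : S.GoodTraining θ train) (h : S.IsAdmissible) (hθ : 0 ≤ θ)
    {a : Fin S.nwk → ℝ} {M : ℝ}
    (ha0 : ∀ i, 0 ≤ a i) (haM : ∀ i, a i ≤ M) (hM : 0 ≤ M) (i : Fin S.nwk) :
    |labelSign (train i).2 * inner ℝ (∑ j, a j • labelSign (train j).2 • patchSum (train j).1)
        (patchSum (train i).1) - a i * ‖S.noisePart (train i)‖ ^ 2| ≤
      M * (S.nwk * (4 * ((2 * S.pe + S.pb) * S.normμ ^ 2) + 6 * (S.pb * S.normν ^ 2) + θ)) := by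
  have key : ∀ j, |a j * (labelSign (train i).2 * labelSign (train j).2 *
      inner ℝ (patchSum (train j).1) (patchSum (train i).1)) -
      (if j = i then a i * ‖S.noisePart (train i)‖ ^ 2 else 0)| ≤
      M * (2 * S.normμ ^ 2 * S.easyCoeff (train j) + 2 * S.normν ^ 2 * |S.hardCoeff (train j)|
        + θ) := by
    intro j
    have ri := g.regular i
    have rj := g.regular j
    rw [patchSum_eq (train j), patchSum_eq (train i),
      h.inner_combination rj.isNoise ri.isNoise]
    set x := (if (train j).2 = (train i).2 then
      S.easyCoeff (train j) * S.easyCoeff (train i) * S.normμ ^ 2 +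
      S.hardCoeff (train j) * S.hardCoeff (train i) * S.normν ^ 2 else 0) with hx
    have hbj := abs_nonneg (S.hardCoeff (train j))
    have hxb : |x| ≤ 2 * S.normμ ^ 2 * S.easyCoeff (train j) +
        2 * S.normν ^ 2 * |S.hardCoeff (train j)| := by
      have := rj.easyCoeff_nonneg
      rw [hx]
      split_ifs
      · refine (abs_add_le _ _).trans (add_le_add ?_ ?_)
        · rw [abs_mul, abs_mul, abs_of_nonneg this, abs_of_nonneg ri.easyCoeff_nonneg,
            abs_of_nonneg (sq_nonneg _)]
          have := mul_le_mul_of_nonneg_left ri.easyCoeff_le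
            (mul_nonneg (sq_nonneg S.normμ) this)
          linarith
        · rw [abs_mul, abs_mul, abs_of_nonneg (sq_nonneg S.normν)]
          have := mul_le_mul_of_nonneg_left ri.abs_hardCoeff_le
            (mul_nonneg (sq_nonneg S.normν) hbj)
          linarith
      · rw [abs_zero]; positivity
    have hxb0 := (abs_nonneg x).trans hxb
    have hs : |labelSign (train i).2 * labelSign (train j).2| = 1 := by
      rw [abs_mul, abs_labelSign, abs_labelSign, one_mul]
    by_cases hij : j = i
    · subst hij
      -- On the diagonal the noise term is removed exactly, and the example's own signal remains as
      -- error.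
      rw [if_pos rfl, labelSign_mul_self, real_inner_self_eq_norm_sq]
      have : a j * (1 * (x + ‖S.noisePart (train j)‖ ^ 2)) - a j * ‖S.noisePart (train j)‖ ^ 2
          = a j * x := by ring
      rw [this, abs_mul, abs_of_nonneg (ha0 j)]
      apply mul_le_mul (haM j) (by linarith) (abs_nonneg _) hM
    · rw [if_neg hij, sub_zero, abs_mul, abs_mul, hs, one_mul, abs_of_nonneg (ha0 j)]
      apply mul_le_mul (haM j) _ (abs_nonneg _) hM
      exact (abs_add_le _ _).trans (add_le_add hxb (g.inner_le j i hij))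
  have e : labelSign (train i).2 * inner ℝ
      (∑ j, a j • labelSign (train j).2 • patchSum (train j).1) (patchSum (train i).1)
        - a i * ‖S.noisePart (train i)‖ ^ 2 =
      ∑ j, (a j * (labelSign (train i).2 * labelSign (train j).2 *
      inner ℝ (patchSum (train j).1) (patchSum (train i).1)) -
      (if j = i then a i * ‖S.noisePart (train i)‖ ^ 2 else 0)) := by
    rw [Finset.sum_sub_distrib, Finset.sum_ite_eq' Finset.univ i, if_pos (Finset.mem_univ _),
      sum_inner, Finset.mul_sum]
    congr 1
    refine Finset.sum_congr rfl fun j _ => ?_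
    rw [real_inner_smul_left, real_inner_smul_left]; ring
  rw [e]
  refine (Finset.abs_sum_le_sum_abs _ _).trans ((Finset.sum_le_sum fun j _ => key j).trans ?_)
  rw [← Finset.mul_sum, Finset.sum_add_distrib, Finset.sum_add_distrib, ← Finset.mul_sum,
    ← Finset.mul_sum]
  refine mul_le_mul_of_nonneg_left ?_ hM
  have h1 := mul_le_mul_of_nonneg_left g.easy_upper (sq_nonneg S.normμ)
  have h2 := mul_le_mul_of_nonneg_left g.hard_upper (sq_nonneg S.normν)
  simp only [Finset.sum_const, Finset.card_univ, Fintype.card_fin, nsmul_eq_mul]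
  linarith

/-- Examples of label `y` push along `μ y` with nonnegative weights, so the easy parts cannot
cancel; the other label drops out by orthogonality. The signs of the hard parts are arbitrary, so
these are bounded in absolute value with the upper coefficient `hi`. The range `1 ≤ c`, `|b| ≤ 1`
covers both easy-only and both-signal test points. -/
lemma signal_margin (g : S.GoodTraining θ train) (h : S.IsAdmissible)
    {a : Fin S.nwk → ℝ} {lo hi : ℝ} (hlo : 0 ≤ lo)
    (ha0 : ∀ i, lo ≤ a i) (hahi : ∀ i, a i ≤ hi) (y : ℤˣ) {c b : ℝ} (hc : 1 ≤ c) (hb : |b| ≤ 1) :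
    lo * (S.nwk * ((2 * S.pe + S.pb) * S.normμ ^ 2 / 4)) - hi * (S.nwk * (3 * (S.pb * S.normν ^ 2)))
      ≤ labelSign y * inner ℝ (∑ j, a j • labelSign (train j).2 • patchSum (train j).1)
        (c • S.μ y + b • S.ν y) := by
  have key : ∀ j, lo * S.normμ ^ 2 * (if (train j).2 = y then S.easyCoeff (train j) else 0)
      - hi * S.normν ^ 2 * |S.hardCoeff (train j)| ≤
      a j * (labelSign y * labelSign (train j).2 *
        inner ℝ (patchSum (train j).1) (c • S.μ y + b • S.ν y)) := by
    intro j
    have rj := g.regular j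
    have haj := hlo.trans (ha0 j)
    have hhi := haj.trans (hahi j)
    have hbj := abs_nonneg (S.hardCoeff (train j))
    rw [patchSum_eq (train j), ← add_zero (c • S.μ y + b • S.ν y),
      h.inner_combination rj.isNoise isNoise_zero, inner_zero_right, add_zero]
    split_ifs with hy
    · rw [hy, labelSign_mul_self, one_mul, mul_add, sub_eq_add_neg]
      apply add_le_add
      · have h1 : S.easyCoeff (train j) * 1 ≤ S.easyCoeff (train j) * c :=
          mul_le_mul_of_nonneg_left hc rj.easyCoeff_nonneg
        have h2 := mul_le_mul_of_nonneg_right h1 (sq_nonneg S.normμ)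
        have h3 := mul_le_mul (ha0 j) h2 (by have := rj.easyCoeff_nonneg; positivity) haj
        linarith
      · have h1 : |S.hardCoeff (train j) * b| ≤ |S.hardCoeff (train j)| := by
          rw [abs_mul]; exact mul_le_of_le_one_right hbj hb
        have h2 := (abs_le.1 h1).1
        have h3 := mul_le_mul_of_nonneg_right h2 (sq_nonneg S.normν)
        have h4 := mul_le_mul_of_nonneg_left h3 haj
        have h5 := mul_le_mul_of_nonneg_right (hahi j) (mul_nonneg hbj (sq_nonneg S.normν))
        linarith
    · have : 0 ≤ hi * S.normν ^ 2 * |S.hardCoeff (train j)| := by positivity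
      simp only [mul_zero]; linarith
  have e : labelSign y * inner ℝ (∑ j, a j • labelSign (train j).2 • patchSum (train j).1)
        (c • S.μ y + b • S.ν y) = ∑ j, a j * (labelSign y * labelSign (train j).2 *
        inner ℝ (patchSum (train j).1) (c • S.μ y + b • S.ν y)) := by
    rw [sum_inner, Finset.mul_sum]
    refine Finset.sum_congr rfl fun j _ => ?_
    rw [real_inner_smul_left, real_inner_smul_left]; ring
  rw [e]
  refine le_trans ?_ (Finset.sum_le_sum fun j _ => key j)
  rw [Finset.sum_sub_distrib, ← Finset.mul_sum, ← Finset.mul_sum]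
  -- Nonnegativity of `hi` is read off from an index, so the empty training set is treated apart.
  rcases Nat.eq_zero_or_pos S.nwk with hn | hn
  · have : IsEmpty (Fin S.nwk) := by rw [hn]; infer_instance
    simp [hn]
  have hhi : 0 ≤ hi := hlo.trans ((ha0 ⟨0, hn⟩).trans (hahi ⟨0, hn⟩))
  have h1 := mul_le_mul_of_nonneg_left (g.easy_lower y) (mul_nonneg hlo (sq_nonneg S.normμ))
  have h2 := mul_le_mul_of_nonneg_left g.hard_upper (mul_nonneg hhi (sq_nonneg S.normν))
  linarith

/-- The diagonal contributes `n` squared norms; near-orthogonality limits the `n²` cross terms to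
`θ` each. -/
lemma norm_noiseSum_sq_le (g : S.GoodTraining θ train) (hθ : 0 ≤ θ)
    {a : Fin S.nwk → ℝ} {hi : ℝ} (ha0 : ∀ i, 0 ≤ a i) (hahi : ∀ i, a i ≤ hi) :
    ‖noiseSum train a‖ ^ 2 ≤ hi ^ 2 * (S.nwk * (4 * (S.σp ^ 2 * S.d) + S.nwk * θ)) := by
  rw [← real_inner_self_eq_norm_sq, noiseSum, sum_inner]
  have key : ∀ i, inner ℝ (a i • labelSign (train i).2 • S.noisePart (train i))
      (∑ j, a j • labelSign (train j).2 • S.noisePart (train j)) ≤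
      hi ^ 2 * (4 * (S.σp ^ 2 * S.d) + S.nwk * θ) := by
    intro i
    have hi0 := (ha0 i).trans (hahi i)
    rw [inner_sum]
    have : ∀ j, inner ℝ (a i • labelSign (train i).2 • S.noisePart (train i))
        (a j • labelSign (train j).2 • S.noisePart (train j)) ≤
        hi ^ 2 * (if i = j then 4 * (S.σp ^ 2 * S.d) else 0) + hi ^ 2 * θ := by
      intro j
      refine (le_abs_self _).trans ?_
      simp only [real_inner_smul_left, real_inner_smul_right, abs_mul, abs_labelSign, one_mul,
        abs_of_nonneg (ha0 _)]
      have hp : a i * a j ≤ hi ^ 2 := by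
        rw [sq]; exact mul_le_mul (hahi i) (hahi j) (ha0 j) hi0
      have hp0 := mul_nonneg (ha0 i) (ha0 j)
      have hθ2 : 0 ≤ hi ^ 2 * θ := by positivity
      by_cases hij : i = j
      · subst hij
        rw [if_pos rfl, real_inner_self_eq_norm_sq, abs_of_nonneg (sq_nonneg _)]
        have := mul_le_mul hp (g.norm_upper i) (sq_nonneg _) (sq_nonneg hi)
        linarith
      · rw [if_neg hij]
        have := mul_le_mul hp (g.inner_le i j hij) (abs_nonneg _) (sq_nonneg hi)
        linarith
    refine (Finset.sum_le_sum fun j _ => this j).trans ?_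
    rw [Finset.sum_add_distrib, ← Finset.mul_sum, Finset.sum_ite_eq Finset.univ i,
      if_pos (Finset.mem_univ _)]
    simp only [Finset.sum_const, Finset.card_univ, Fintype.card_fin, nsmul_eq_mul]
    linarith
  refine (Finset.sum_le_sum fun i _ => key i).trans ?_
  simp only [Finset.sum_const, Finset.card_univ, Fintype.card_fin, nsmul_eq_mul]
  linarith

end GoodTraining

end Setting

/-! ### Numerical consequences of the parameter conditions. -/

namespace Setting

variable {S : Setting} {C : ℝ}

/-- The logarithmic factor `log (C n² / δ)` of the dimension condition. -/
noncomputable def logFactor (S : Setting) (C : ℝ) : ℝ := Real.log (C * (S.nwk : ℝ) ^ 2 / S.δ)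

/-- A high-probability bound on the inner products of distinct noise vectors. -/
noncomputable def crossBound (S : Setting) (C : ℝ) : ℝ :=
  4 * S.σp ^ 2 * Real.sqrt (S.d * S.logFactor C)

lemma IsAdmissible.log_Tstar_ge (h : S.IsAdmissible) : 0.69 ≤ Real.log S.Tstar :=
  le_trans (by linarith [Real.log_two_gt_d9]) (Real.log_le_log (by norm_num) h.two_le_Tstar)

lemma IsAdmissible.easyMass_pos (h : S.IsAdmissible) : 0 < 2 * S.pe + S.pb := by
  linarith [h.pe_pos, h.pb_pos]

lemma IsAdmissible.log_Tstar_pos (h : S.IsAdmissible) : 0 < Real.log S.Tstar := by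
  linarith [h.log_Tstar_ge]

lemma crossBound_nonneg : 0 ≤ S.crossBound C := by
  unfold crossBound; positivity

namespace DataScarce

variable (h : S.DataScarce C) (hC : 10 ^ 8 ≤ C)

include h hC

lemma log_div_pos : 0 < Real.log (C / S.δ) := by
  apply Real.log_pos
  rw [lt_div_iff₀ h.δ_pos]
  linarith [h.δ_lt_one]

lemma nwk_pos : 0 < S.nwk := by
  have h1 := h.log_div_pos hC
  have h2 : 0 < (S.pe ^ 2)⁻¹ := by have := h.pe_pos; positivity
  have h3 : 0 < max (max (S.pe ^ 2)⁻¹ (S.pb ^ 2)⁻¹) (S.ph ^ 2)⁻¹ :=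
    h2.trans_le ((le_max_left _ _).trans (le_max_left _ _))
  have h4 := h.nwk_large
  have h5 : (0 : ℝ) < S.nwk := lt_of_lt_of_le (by positivity) h4
  exact_mod_cast h5

lemma one_le_nwk : (1 : ℝ) ≤ S.nwk := by exact_mod_cast h.nwk_pos hC

lemma log_div_le_logFactor : Real.log (C / S.δ) ≤ S.logFactor C := by
  have h1 := h.one_le_nwk hC
  have := h.δ_pos
  apply Real.log_le_log (by positivity)
  gcongr
  exact le_mul_of_one_le_right (by linarith) (one_le_pow₀ h1)

lemma logFactor_pos : 0 < S.logFactor C :=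
  (h.log_div_pos hC).trans_le (h.log_div_le_logFactor hC)

lemma dim_ge : C * S.nwk ^ 2 * S.logFactor C * Real.log S.Tstar ^ 2 ≤ S.d := by
  refine le_trans ?_ h.high_dim
  have := le_max_left ((S.nwk : ℝ) ^ 2 * Real.log (C * (S.nwk : ℝ) ^ 2 / S.δ))
      ((S.nst : ℝ) * Real.log (C * (S.nst : ℝ) / S.δ))
  have h2 : C * ((S.nwk : ℝ) ^ 2 * S.logFactor C) * Real.log S.Tstar ^ 2 ≤ _ :=
    mul_le_mul_of_nonneg_right (mul_le_mul_of_nonneg_left this (by linarith)) (sq_nonneg _)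
  linarith

lemma dim_pos : (0 : ℝ) < S.d := by
  have h1 := h.one_le_nwk hC
  have h2 := h.logFactor_pos hC
  have h3 := h.log_Tstar_pos
  exact lt_of_lt_of_le (by positivity) (h.dim_ge hC)

lemma noiseScale_pos : 0 < S.σp ^ 2 * S.d := by
  have := h.dim_pos hC
  have := h.σp_pos
  positivity

lemma scarce : C * (S.nwk * ((2 * S.pe + S.pb) * S.normμ ^ 2) * Real.log S.Tstar) ≤
    S.σp ^ 2 * S.d := by
  have h1 := h.log_Tstar_pos
  have h2 := h.normμ_pos
  have h3 := h.easyMass_pos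
  have h4 := h.nwk_scarce
  have h5 : C⁻¹ * (S.σp ^ 2 * (S.d : ℝ) / ((2 * S.pe + S.pb) * S.normμ ^ 2 * Real.log S.Tstar))
    = S.σp ^ 2 * S.d / (C * ((2 * S.pe + S.pb) * S.normμ ^ 2 * Real.log S.Tstar)) := by
    field_simp
  rw [h5, le_div_iff₀ (by positivity)] at h4
  linarith

/-- This keeps the effective step `η ‖ξ i‖² / n` of every scalar recursion at most 1; of the
learning rate condition only the consequence `d ^ (-3/2) ≤ d⁻¹` is needed. -/
lemma step_size : S.η * (4 * (S.σp ^ 2 * S.d)) ≤ S.nwk := by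
  have h1 : (1 : ℝ) ≤ S.d := by
    have := h.dim_pos hC
    exact_mod_cast this
  have h0 := h.σp_pos
  have h2 : (S.d : ℝ) ^ (-(3 / 2) : ℝ) ≤ (S.d : ℝ)⁻¹ := by
    rw [← Real.rpow_neg_one]
    exact Real.rpow_le_rpow_of_exponent_le h1 (by norm_num)
  have h3 : S.η ≤ C⁻¹ * (S.σp ^ 2)⁻¹ * (S.d : ℝ)⁻¹ := by
    refine h.lr_small.trans ?_
    gcongr
  have hD := h.noiseScale_pos hC
  calc S.η * (4 * (S.σp ^ 2 * S.d)) ≤ (C⁻¹ * (S.σp ^ 2)⁻¹ * (S.d : ℝ)⁻¹) *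
        (4 * (S.σp ^ 2 * S.d)) := by gcongr
    _ = 4 / C := by field_simp
    _ ≤ 1 := by rw [div_le_one (by linarith)]; linarith
    _ ≤ S.nwk := h.one_le_nwk hC

lemma ph_le : C * S.ph ≤ S.pb :=
  (mul_le_mul_of_nonneg_left (le_max_left _ _) (by linarith)).trans h.both_large

/-- Squared, this is the dimension condition `d ≥ C n² log (C n² / δ) (log T*)²`. Here `C ≥ 10 ^ 8`
is used in full: `√(10 ^ 8) = 10000` and `10000 / 4 = 2500`. -/
lemma crossBound_le : S.nwk * S.crossBound C * Real.log S.Tstar ≤ S.σp ^ 2 * S.d / 2500 := by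
  have h0 := h.log_Tstar_pos
  have h1 := h.one_le_nwk hC
  have h2 := h.logFactor_pos hC
  have h4 : S.nwk * Real.sqrt (S.d * S.logFactor C) * Real.log S.Tstar ≤ S.d / 10000 := by
    apply abs_le_of_sq_le_sq' _ (by positivity) |>.2
    rw [mul_pow, mul_pow, Real.sq_sqrt (by positivity)]
    have h5 : 10 ^ 8 * (S.nwk ^ 2 * S.logFactor C * Real.log S.Tstar ^ 2) ≤ S.d := by
      refine le_trans ?_ (h.dim_ge hC)
      rw [mul_assoc C, mul_assoc C]
      gcongr
    have h6 := mul_le_mul_of_nonneg_left h5 (h.dim_pos hC).le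
    linarith
  unfold crossBound
  have := mul_le_mul_of_nonneg_left h4 (sq_nonneg S.σp)
  linarith

end DataScarce

/-! ### The trajectory on a good training set. -/

namespace GoodTraining

variable {train : Fin S.nwk → DataPoint S.d} (g : S.GoodTraining (S.crossBound C) train)
  (h : S.DataScarce C) (hC : 10 ^ 8 ≤ C)

include g h hC

lemma noise_norm_sq_pos (i : Fin S.nwk) : 0 < ‖S.noisePart (train i)‖ ^ 2 :=
  lt_of_lt_of_le (by have := h.noiseScale_pos hC; positivity) (g.norm_lower i)

lemma margin_close {a : Fin S.nwk → ℝ}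
    (ha : ∀ i, 0 ≤ a i ∧ a i * ‖S.noisePart (train i)‖ ^ 2 ≤ 4 * Real.log S.Tstar)
    (i : Fin S.nwk) :
    |labelSign (train i).2 * inner ℝ (∑ j, a j • labelSign (train j).2 • patchSum (train j).1)
        (patchSum (train i).1) - a i * ‖S.noisePart (train i)‖ ^ 2| ≤ 1 := by
  have hT := h.log_Tstar_pos
  have hD := h.noiseScale_pos hC
  -- `20 = 4 * 5`: the logarithmic bound `4 log T*` divided by `‖ξ i‖² ≥ D / 5`.
  have hM : ∀ i, a i ≤ 20 * Real.log S.Tstar / (S.σp ^ 2 * S.d) := by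
    intro i
    rw [le_div_iff₀ hD]
    have := mul_le_mul_of_nonneg_left (g.norm_lower i) (ha i).1
    linarith [(ha i).2]
  refine (g.margin_approx h.toIsAdmissible crossBound_nonneg (fun i => (ha i).1) hM
    (by positivity) i).trans ?_
  rw [div_mul_eq_mul_div, div_le_one hD]
  have h1 := h.scarce hC
  have h2 := h.crossBound_le hC
  have h3 := mul_le_mul_of_nonneg_left h.easy_dominates
    (show 0 ≤ (S.nwk : ℝ) * Real.log S.Tstar by positivity)
  have hx : 0 ≤ S.nwk * ((2 * S.pe + S.pb) * S.normμ ^ 2) * Real.log S.Tstar := by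
    have := h.easyMass_pos; positivity
  have hy : 0 ≤ S.nwk * (S.pb * S.normν ^ 2) * Real.log S.Tstar := by
    have := h.pb_pos; positivity
  have h4 := mul_le_mul_of_nonneg_right hC hx
  have h5 := mul_le_mul_of_nonneg_right hC hy
  linarith

/-- Along the trajectory, the margins are controlled by the coefficients, which grow
logarithmically. -/
lemma gdCoeff_bounds (t : ℕ) (ht : (t : ℝ) ≤ S.Tstar) (i : Fin S.nwk) :
    0 ≤ gdCoeff S.η train t i ∧
    gdCoeff S.η train t i * ‖S.noisePart (train i)‖ ^ 2 ≤ 4 * Real.log S.Tstar ∧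
    1 + S.η / S.nwk * ‖S.noisePart (train i)‖ ^ 2 / 6 * t ≤
      Real.exp (gdCoeff S.η train t i * ‖S.noisePart (train i)‖ ^ 2) ∧
    Real.exp (gdCoeff S.η train t i * ‖S.noisePart (train i)‖ ^ 2) ≤
      1 + 6 * (S.η / S.nwk * ‖S.noisePart (train i)‖ ^ 2) * t := by
  have hn := h.nwk_pos hC
  refine exp_growth_bounds (a := gdCoeff S.η train)
    (z := fun t i => labelSign (train i).2 * weakModel (weakIterate S.η train t) (train i).1)
    (D := fun i => ‖S.noisePart (train i)‖ ^ 2) (h := S.η / S.nwk) h.two_le_Tstar ?_ ?_ ?_ ?_ ?_ ?_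
    t ht i
  · intro i; rfl
  · have := h.η_pos; positivity
  · exact g.noise_norm_sq_pos h hC
  · intro i
    rw [div_mul_eq_mul_div, div_le_one (by exact_mod_cast hn)]
    refine le_trans ?_ (h.step_size hC)
    have := h.η_pos
    gcongr
    exact g.norm_upper i
  · intro t i; rfl
  · intro t ha i
    rw [weakModel_eq_inner, weakIterate_eq_sum]
    exact g.margin_close h hC ha i

/-- Every `exp (a i ‖ξ i‖²)` is `1` plus a multiple of `t` known up to constants. Bernoulli's
inequality `1 + 720 y ≤ (1 + y) ^ 720` turns a constant factor inside the logarithm into one outside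
it, uniformly in `t`. -/
lemma gdCoeff_comparable (t : ℕ) (ht : (t : ℝ) ≤ S.Tstar) :
    ∃ lo : ℝ, 0 ≤ lo ∧ (0 < t → 0 < lo) ∧
      ∀ i, lo ≤ gdCoeff S.η train t i ∧ gdCoeff S.η train t i ≤ 14400 * lo := by
  have hn : (0 : ℝ) < S.nwk := by exact_mod_cast h.nwk_pos hC
  have hD := h.noiseScale_pos hC
  have hη := h.η_pos
  set D := S.σp ^ 2 * (S.d : ℝ) with hDdef
  set y := S.η / S.nwk * D / 30 * t with hy
  have hy0 : 0 ≤ y := by positivity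
  have hlog : 0 ≤ Real.log (1 + y) := Real.log_nonneg (by linarith)
  refine ⟨Real.log (1 + y) / (4 * D), by positivity, ?_, ?_⟩
  · intro ht
    have ht : (0 : ℝ) < t := by exact_mod_cast ht
    have hy1 : 0 < y := by positivity
    exact div_pos (Real.log_pos (by linarith)) (by positivity)
  · intro i
    obtain ⟨h0, -, h1, h2⟩ := g.gdCoeff_bounds h hC t ht i
    have hl := g.norm_lower i
    have hu := g.norm_upper i
    rw [← hDdef] at hl hu
    set Di := ‖S.noisePart (train i)‖ ^ 2
    set a := gdCoeff S.η train t i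
    constructor
    · rw [div_le_iff₀ (by positivity)]
      have h3 : 1 + y ≤ Real.exp (a * Di) := by
        refine le_trans ?_ h1
        have : S.η / S.nwk * (D / 5) / 6 * t ≤ S.η / S.nwk * Di / 6 * t := by gcongr
        linarith
      have h4 := (Real.log_le_iff_le_exp (by linarith)).2 h3
      exact h4.trans (mul_le_mul_of_nonneg_left hu h0)
    -- `720 = 6 * 4 * 30`, from the growth rate, the upper norm bound and the normalization of `y`.
    -- Below, `720 * 5 * 4 = 14400`.
    · have h3 : Real.exp (a * Di) ≤ 1 + 720 * y := by
        refine h2.trans ?_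
        have : 6 * (S.η / S.nwk * Di) * t ≤ 6 * (S.η / S.nwk * (4 * D)) * t := by gcongr
        linarith
      have h4 : 1 + 720 * y ≤ (1 + y) ^ 720 := by
        have := one_add_mul_le_pow (a := y) (by linarith) 720
        exact_mod_cast this
      have h5 : a * Di ≤ 720 * Real.log (1 + y) := by
        have := (Real.le_log_iff_exp_le (by positivity)).2 (h3.trans h4)
        rw [Real.log_pow] at this
        exact_mod_cast this
      have h6 := mul_le_mul_of_nonneg_left hl h0
      have : 14400 * (Real.log (1 + y) / (4 * D)) = 3600 * Real.log (1 + y) / D := by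
        field_simp; ring
      rw [this, le_div_iff₀ hD]
      linarith

lemma trainingLoss_lt {t : ℕ} (ht : (t : ℝ) ≤ S.Tstar) (hB : S.timeBound 100 0 < t + 1) :
    trainingLoss train (weakIterate S.η train t) < S.ε := by
  have hn : (0 : ℝ) < S.nwk := by exact_mod_cast h.nwk_pos hC
  have hD := h.noiseScale_pos hC
  have hη := h.η_pos
  have hε := h.ε_pos
  have hd := h.dim_pos hC
  have hσ := h.σp_pos
  set D := S.σp ^ 2 * (S.d : ℝ) with hDdef
  set q := S.η / S.nwk * D / 30 with hq
  have hq0 : 0 < q := by positivity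
  have hq1 : q ≤ 1 := by
    have h1 := h.step_size hC
    rw [hq, div_mul_eq_mul_div, div_div, div_le_one (by positivity)]
    linarith
  have hqB : q * S.timeBound 100 0 = 10 / (3 * S.ε) := by
    rw [hq, hDdef, timeBound]; field_simp; norm_num
  -- Only `t + 1` exceeds the time bound; the missing step costs `q ≤ 1`, which the summand 1
  -- absorbs.
  have hbig : 10 / (3 * S.ε) < 1 + q * t := by
    rw [← hqB]
    have := mul_lt_mul_of_pos_left hB hq0
    linarith
  have hpos : 0 < 1 + q * t := by positivity
  have key : ∀ i, logisticLoss (labelSign (train i).2 *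
      weakModel (weakIterate S.η train t) (train i).1) ≤ 3 / (1 + q * t) := by
    intro i
    obtain ⟨h0, h0', h1, h2⟩ := g.gdCoeff_bounds h hC t ht i
    have hc := g.margin_close h hC (a := gdCoeff S.η train t)
      (fun i => ⟨(g.gdCoeff_bounds h hC t ht i).1, (g.gdCoeff_bounds h hC t ht i).2.1⟩) i
    rw [← weakIterate_eq_sum, ← weakModel_eq_inner] at hc
    have hc := (abs_le.1 hc).1
    refine (logisticLoss_le_exp_neg _).trans ?_
    set Di := ‖S.noisePart (train i)‖ ^ 2
    set a := gdCoeff S.η train t i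
    have h3 : 1 + q * t ≤ Real.exp (a * Di) := by
      refine le_trans ?_ h1
      have hl := g.norm_lower i
      have : S.η / S.nwk * (D / 5) / 6 * t ≤ S.η / S.nwk * Di / 6 * t := by gcongr
      rw [hq]
      linarith
    calc _ ≤ Real.exp (1 - a * Di) := Real.exp_le_exp.2 (by linarith)
      _ = Real.exp 1 / Real.exp (a * Di) := Real.exp_sub _ _
      _ ≤ 3 / (1 + q * t) := by
        have := Real.exp_one_lt_d9
        gcongr
        linarith
  unfold trainingLoss
  have hsum : ∑ i, logisticLoss (labelSign (train i).2 *
      weakModel (weakIterate S.η train t) (train i).1) ≤ S.nwk * (3 / (1 + q * t)) := by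
    refine (Finset.sum_le_sum fun i _ => key i).trans ?_
    simp
  calc _ ≤ 1 / (S.nwk : ℝ) * (S.nwk * (3 / (1 + q * t))) := by gcongr
    _ = 3 / (1 + q * t) := by field_simp
    _ < S.ε := by
      rw [div_lt_iff₀ hpos]
      rw [div_lt_iff₀ (by positivity)] at hbig
      linarith

/-- After the first step, the signal learned by the weak model dominates the noise it
memorized. -/
lemma signal_to_noise {t : ℕ} (ht0 : 0 < t) (ht : (t : ℝ) ≤ S.Tstar) :
    ∃ m > 0, (∀ y (c b : ℝ), 1 ≤ c → |b| ≤ 1 →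
        m ≤ labelSign y * inner ℝ (weakIterate S.η train t) (c • S.μ y + b • S.ν y)) ∧
      ∃ V > 0, ‖noiseSum train (gdCoeff S.η train t)‖ ^ 2 ≤ V ∧
        Real.exp (-(m ^ 2 / (2 * (S.σp ^ 2 * V)))) ≤ S.errorBound (640 * 14400 ^ 2) := by
  obtain ⟨lo, -, hlo, hb⟩ := g.gdCoeff_comparable h hC t ht
  have hlo := hlo ht0
  have hn : (0 : ℝ) < S.nwk := by exact_mod_cast h.nwk_pos hC
  have hD := h.noiseScale_pos hC
  have hμ := h.normμ_pos
  have hP := h.easyMass_pos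
  have hd := h.dim_pos hC
  have hσ := h.σp_pos
  have ha0 : ∀ i, 0 ≤ gdCoeff S.η train t i := fun i => hlo.le.trans (hb i).1
  -- Half of the easy contribution `1 / 4` is kept. The other half absorbs the hard term, whose
  -- factor `3 * 14400` is beaten by `C` through `easy_dominates`.
  refine ⟨lo * (S.nwk * ((2 * S.pe + S.pb) * S.normμ ^ 2 / 8)), by positivity, ?_, ?_⟩
  · intro y c b hc hb1
    rw [weakIterate_eq_sum]
    refine le_trans ?_ (g.signal_margin h.toIsAdmissible hlo.le (fun i => (hb i).1)
      (fun i => (hb i).2) y hc hb1)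
    have h1 := mul_le_mul_of_nonneg_left h.easy_dominates
      (show 0 ≤ lo * (S.nwk : ℝ) by positivity)
    have hy : 0 ≤ lo * (S.nwk * (S.pb * S.normν ^ 2)) := by
      have := h.pb_pos; positivity
    have h2 := mul_le_mul_of_nonneg_right hC hy
    linarith
  · have h1 := g.norm_noiseSum_sq_le crossBound_nonneg ha0 (fun i => (hb i).2)
    have h2 : S.nwk * S.crossBound C ≤ S.σp ^ 2 * S.d := by
      have h3 := h.crossBound_le hC
      have h4 := h.log_Tstar_ge
      have h5 : 0 ≤ S.nwk * S.crossBound C := mul_nonneg hn.le crossBound_nonneg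
      have h6 := mul_le_mul_of_nonneg_left h4 h5
      linarith
    refine ⟨(14400 * lo) ^ 2 * (S.nwk * (5 * (S.σp ^ 2 * S.d))), by positivity, ?_, ?_⟩
    · refine h1.trans ?_
      gcongr
      linarith
    -- Here `lo` cancels, and `640 = 8² * 2 * 5` collects the margin factor, the Gaussian exponent
    -- and the constant in `V`.
    · apply le_of_eq
      unfold errorBound
      congr 2
      field_simp
      norm_num

end GoodTraining

end Setting

/-! ### Tails of the standard Gaussian. -/

section GaussianTails

variable {E : Type*} [NormedAddCommGroup E] [InnerProductSpace ℝ E] [FiniteDimensional ℝ E]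
  [MeasurableSpace E] [BorelSpace E]

lemma hasSubgaussianMGF_inner_stdGaussian (u : E) {V : NNReal} (hV : ‖u‖ ^ 2 ≤ V) :
    HasSubgaussianMGF (fun g => inner ℝ u g) V (stdGaussian E) := by
  have hmap : (stdGaussian E).map (innerSL ℝ u) = gaussianReal 0 (‖u‖ ^ 2).toNNReal := by
    rw [IsGaussian.map_eq_gaussianReal, variance_dual_stdGaussian, integral_strongDual_stdGaussian,
      innerSL_apply_norm]
  have hmgf := mgf_gaussianReal hmap
  constructor
  · intro t
    -- A non-integrable function has Bochner integral 0 by convention, so the nonzero value of the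
    -- integral proves integrability.
    apply Integrable.of_integral_ne_zero
    have := hmgf t
    unfold mgf at this
    simp only [innerSL_apply_apply] at this
    rw [this]
    positivity
  · intro t
    refine (hmgf t).le.trans ?_
    rw [Real.exp_le_exp, Real.coe_toNNReal _ (sq_nonneg _), zero_mul, zero_add]
    gcongr

lemma stdGaussian_inner_ge_le (u : E) {V r : ℝ} (hV : ‖u‖ ^ 2 ≤ V) (hr : 0 ≤ r) :
    stdGaussian E {g | r ≤ inner ℝ u g} ≤ ENNReal.ofReal (Real.exp (-(r ^ 2 / (2 * V)))) := by
  have hV0 := (sq_nonneg ‖u‖).trans hV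
  have := (hasSubgaussianMGF_inner_stdGaussian u (V := ⟨V, hV0⟩) hV).measure_ge_le hr
  rw [← ENNReal.ofReal_toReal (measure_ne_top (stdGaussian E) _)]
  apply ENNReal.ofReal_le_ofReal
  refine this.trans (le_of_eq ?_)
  rw [neg_div]
  rfl

lemma stdGaussian_abs_inner_ge_le (u : E) {V r : ℝ} (hV : ‖u‖ ^ 2 ≤ V) (hr : 0 ≤ r) :
    stdGaussian E {g | r ≤ |inner ℝ u g|} ≤
      2 * ENNReal.ofReal (Real.exp (-(r ^ 2 / (2 * V)))) := by
  have h1 := stdGaussian_inner_ge_le u hV hr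
  have h2 := stdGaussian_inner_ge_le (-u) (V := V) (by rwa [norm_neg]) hr
  rw [two_mul]
  refine le_trans ?_ ((measure_union_le _ _).trans (add_le_add h1 h2))
  apply measure_mono
  intro g hg
  rw [Set.mem_ofPred_eq] at hg
  rcases le_abs.1 hg with h | h
  · exact Or.inl h
  · exact Or.inr (by simpa [inner_neg_left] using h)

lemma integral_exp_mul_sq_gaussianReal {t : ℝ} (ht : t < 1 / 2) :
    ∫ x, Real.exp (t * x ^ 2) ∂(gaussianReal 0 1) = Real.sqrt (1 / (1 - 2 * t)) := by
  rw [integral_gaussianReal_eq_integral_smul (by norm_num)]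
  have : ∀ x : ℝ, gaussianPDFReal 0 1 x • Real.exp (t * x ^ 2) =
      (Real.sqrt (2 * Real.pi))⁻¹ * Real.exp (-(1 / 2 - t) * x ^ 2) := by
    intro x
    rw [gaussianPDFReal, smul_eq_mul, mul_assoc, ← Real.exp_add]
    simp only [NNReal.coe_one, mul_one, sub_zero]
    congr 2
    ring
  simp_rw [this]
  rw [integral_const_mul, integral_gaussian, ← Real.sqrt_inv, ← Real.sqrt_mul (by positivity)]
  congr 1
  have h1 : (1 / 2 - t) ≠ 0 := by linarith
  have h2 : 1 - 2 * t ≠ 0 := by linarith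
  have := Real.pi_ne_zero
  field_simp

lemma integral_exp_mul_norm_sq_stdGaussian (d : ℕ) {t : ℝ} (ht : t < 1 / 2) :
    ∫ g, Real.exp (t * ‖g‖ ^ 2) ∂(stdGaussian (EuclideanSpace ℝ (Fin d))) =
      Real.sqrt (1 / (1 - 2 * t)) ^ d := by
  rw [← map_pi_eq_stdGaussian, integral_map (by fun_prop) (by fun_prop)]
  simp_rw [EuclideanSpace.real_norm_sq_eq, Finset.mul_sum, Real.exp_sum]
  rw [integral_fintype_prod_eq_pow (fun x : ℝ => Real.exp (t * x ^ 2)),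
    integral_exp_mul_sq_gaussianReal ht, Fintype.card_fin]

lemma integrable_exp_mul_norm_sq_stdGaussian (d : ℕ) {t : ℝ} (ht : t < 1 / 2) :
    Integrable (fun g => Real.exp (t * ‖g‖ ^ 2)) (stdGaussian (EuclideanSpace ℝ (Fin d))) := by
  apply Integrable.of_integral_ne_zero
  rw [integral_exp_mul_norm_sq_stdGaussian d ht]
  have : 0 < 1 - 2 * t := by linarith
  positivity

/-- Chernoff's bound at `t = 1/4`. The comparison `√2 ≤ exp (159/160)` is far from tight; it is
chosen so that `exp (-d / 160)` remains. -/
lemma stdGaussian_norm_sq_ge_le (d : ℕ) :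
    stdGaussian (EuclideanSpace ℝ (Fin d)) {g | 4 * (d : ℝ) ≤ ‖g‖ ^ 2} ≤
      ENNReal.ofReal (Real.exp (-(d / 160))) := by
  have h := measure_ge_le_exp_mul_mgf (μ := stdGaussian (EuclideanSpace ℝ (Fin d)))
    (X := fun g => ‖g‖ ^ 2) (t := 1 / 4) (4 * (d : ℝ)) (by norm_num)
    (integrable_exp_mul_norm_sq_stdGaussian d (by norm_num))
  rw [← ENNReal.ofReal_toReal (measure_ne_top (stdGaussian _) _)]
  apply ENNReal.ofReal_le_ofReal
  refine h.trans ?_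
  rw [mgf, integral_exp_mul_norm_sq_stdGaussian d (by norm_num)]
  have h1 : Real.sqrt (1 / (1 - 2 * (1 / 4))) ≤ Real.exp (159 / 160) := by
    rw [Real.sqrt_le_left (by positivity)]
    have := Real.add_one_le_exp (159 / 160 : ℝ)
    nlinarith
  calc _ ≤ Real.exp (-(1 / 4) * (4 * (d : ℝ))) * Real.exp (159 / 160) ^ d := by gcongr
    _ = _ := by
      rw [← Real.exp_nat_mul, ← Real.exp_add]
      congr 1
      ring

/-- Chernoff's bound at `t = -2`. It rests on `exp (81/80) ≤ 5`, which leaves `80/160 - 81/160 =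
-1/160` per dimension. -/
lemma stdGaussian_norm_sq_le_le (d : ℕ) :
    stdGaussian (EuclideanSpace ℝ (Fin d)) {g | ‖g‖ ^ 2 ≤ (d : ℝ) / 4} ≤
      ENNReal.ofReal (Real.exp (-(d / 160))) := by
  have h := measure_le_le_exp_mul_mgf (μ := stdGaussian (EuclideanSpace ℝ (Fin d)))
    (X := fun g => ‖g‖ ^ 2) (t := -2) ((d : ℝ) / 4) (by norm_num)
    (integrable_exp_mul_norm_sq_stdGaussian d (by norm_num))
  rw [← ENNReal.ofReal_toReal (measure_ne_top (stdGaussian _) _)]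
  apply ENNReal.ofReal_le_ofReal
  refine h.trans ?_
  rw [mgf, integral_exp_mul_norm_sq_stdGaussian d (by norm_num)]
  have h1 : Real.sqrt (1 / (1 - 2 * (-2))) ≤ Real.exp (-(81 / 160)) := by
    rw [Real.sqrt_le_left (by positivity), ← Real.exp_nat_mul]
    have h2 : Real.exp (81 / 80) ≤ 5 := by
      have e : (81 / 80 : ℝ) = 1 + 1 / 80 := by norm_num
      rw [e, Real.exp_add]
      have h3 := Real.exp_one_lt_d9
      have h4 := Real.exp_bound_div_one_sub_of_interval (x := 1 / 80) (by norm_num) (by norm_num)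
      calc Real.exp 1 * Real.exp (1 / 80) ≤ 2.7182818286 * (1 / (1 - 1 / 80)) := by gcongr
        _ ≤ 5 := by norm_num
    have h5 : ((2 : ℕ) : ℝ) * -(81 / 160) = -(81 / 80) := by norm_num
    rw [h5, Real.exp_neg, one_div]
    norm_num
    have := inv_anti₀ (Real.exp_pos _) h2
    linarith
  calc _ ≤ Real.exp (-(-2) * ((d : ℝ) / 4)) * Real.exp (-(81 / 160)) ^ d := by gcongr
    _ = _ := by
      rw [← Real.exp_nat_mul, ← Real.exp_add]
      congr 1
      ring

end GaussianTails

/-! ### The noise law as a projected Gaussian. -/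

namespace Setting

variable {S : Setting}

/-- The orthogonal projection onto the complement of the signals. -/
noncomputable def noiseProj (S : Setting) : Patch S.d →L[ℝ] Patch S.d :=
  Matrix.toEuclideanCLM (𝕜 := ℝ) S.noiseCov

lemma toEuclideanCLM_vecMulVec {d : ℕ} (a v : Patch d) :
    Matrix.toEuclideanCLM (𝕜 := ℝ) (Matrix.vecMulVec (fun i => a i) (fun i => a i)) v =
      (inner ℝ a v : ℝ) • a := by
  ext i
  simp [Matrix.ofLp_toEuclideanCLM, Matrix.vecMulVec_mulVec, PiLp.inner_apply, dotProduct, mul_comm]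

lemma noiseProj_apply (v : Patch S.d) :
    S.noiseProj v = v - ∑ s : ℤˣ, (inner ℝ (S.μ s) v / ‖S.μ s‖ ^ 2) • S.μ s
      - ∑ s : ℤˣ, (inner ℝ (S.ν s) v / ‖S.ν s‖ ^ 2) • S.ν s := by
  simp only [noiseProj, noiseCov, map_sub, map_one, map_sum, map_smul,
    sub_apply, sum_apply, smul_apply,
    toEuclideanCLM_vecMulVec, smul_smul, one_apply_eq_self]
  simp only [div_eq_inv_mul]

lemma noiseCov_isHermitian : S.noiseCov.IsHermitian := by
  unfold noiseCov
  ext i j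
  simp [Matrix.sub_apply, Matrix.vecMulVec_apply, Matrix.one_apply, mul_comm,
    eq_comm]

namespace IsAdmissible

lemma noiseProj_of_isNoise {ξ : Patch S.d} (hξ : S.IsNoise ξ) : S.noiseProj ξ = ξ := by
  rw [noiseProj_apply]
  simp [fun s => (hξ s).1, fun s => (hξ s).2]

lemma isNoise_noiseProj (h : S.IsAdmissible) (v : Patch S.d) : S.IsNoise (S.noiseProj v) := by
  have hμ := (pow_pos h.normμ_pos 2).ne'
  have hν := (pow_pos h.normν_pos 2).ne'
  intro s
  have e1 : ∀ s', inner ℝ (S.μ s) (S.μ s') = if s = s' then S.normμ ^ 2 else 0 := by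
    intro s'
    split_ifs with hs
    · rw [← hs, h.inner_μ_self]
    · exact h.inner_μ_of_ne hs
  have e2 : ∀ s', inner ℝ (S.ν s) (S.ν s') = if s = s' then S.normν ^ 2 else 0 := by
    intro s'
    split_ifs with hs
    · rw [← hs, h.inner_ν_self]
    · exact h.inner_ν_of_ne hs
  rw [noiseProj_apply]
  simp only [inner_sub_right, inner_sum, real_inner_smul_right, h.inner_ν_μ, h.μ_ν_orthogonal, e1,
    e2, h.norm_μ, h.norm_ν, mul_ite, mul_zero, Finset.sum_ite_eq, Finset.mem_univ, if_true,
    Finset.sum_const_zero]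
  exact ⟨by rw [div_mul_cancel₀ _ hμ]; ring, by rw [div_mul_cancel₀ _ hν]; ring⟩

lemma noiseCov_mul_self (h : S.IsAdmissible) : S.noiseCov * S.noiseCov = S.noiseCov := by
  apply (Matrix.toEuclideanCLM (𝕜 := ℝ) (n := Fin S.d)).injective
  rw [map_mul]
  ext1 v
  exact noiseProj_of_isNoise (h.isNoise_noiseProj v)

lemma inner_noiseProj_left (v w : Patch S.d) :
    inner ℝ (S.noiseProj v) w = inner ℝ v (S.noiseProj w) := by
  rw [noiseProj_apply, noiseProj_apply]
  simp only [inner_sub_right, inner_sub_left, inner_sum, sum_inner, real_inner_smul_right,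
    real_inner_smul_left]
  simp only [fun s => real_inner_comm v (S.μ s), fun s => real_inner_comm v (S.ν s)]
  congr 1
  · congr 1
    exact Finset.sum_congr rfl fun s _ => by ring
  · exact Finset.sum_congr rfl fun s _ => by ring

lemma norm_noiseProj_sq (h : S.IsAdmissible) (v : Patch S.d) :
    ‖S.noiseProj v‖ ^ 2 = ‖v‖ ^ 2 - ∑ s : ℤˣ, inner ℝ (S.normμ⁻¹ • S.μ s) v ^ 2
      - ∑ s : ℤˣ, inner ℝ (S.normν⁻¹ • S.ν s) v ^ 2 := by
  rw [← real_inner_self_eq_norm_sq, inner_noiseProj_left,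
    noiseProj_of_isNoise (h.isNoise_noiseProj v), noiseProj_apply]
  simp only [inner_sub_right, inner_sum, real_inner_smul_right, real_inner_smul_left, h.norm_μ,
    h.norm_ν, real_inner_self_eq_norm_sq]
  simp only [fun s => real_inner_comm v (S.μ s), fun s => real_inner_comm v (S.ν s)]
  congr 1
  · congr 1
    exact Finset.sum_congr rfl fun s _ => by ring
  · exact Finset.sum_congr rfl fun s _ => by ring

lemma norm_noiseProj_sq_le (h : S.IsAdmissible) (v : Patch S.d) :
    ‖S.noiseProj v‖ ^ 2 ≤ ‖v‖ ^ 2 := by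
  rw [h.norm_noiseProj_sq]
  have h1 : 0 ≤ ∑ s : ℤˣ, inner ℝ (S.normμ⁻¹ • S.μ s) v ^ 2 := Finset.sum_nonneg fun _ _ =>
    sq_nonneg _
  have h2 : 0 ≤ ∑ s : ℤˣ, inner ℝ (S.normν⁻¹ • S.ν s) v ^ 2 := Finset.sum_nonneg fun _ _ =>
    sq_nonneg _
  linarith

open scoped MatrixOrder in
-- Since `Λ` is a symmetric idempotent, it is positive semidefinite and the square root of `σp² Λ`
-- is `σp Λ`.
lemma noiseLaw_eq_map (h : S.IsAdmissible) :
    S.noiseLaw = (stdGaussian (Patch S.d)).map (fun g => S.σp • S.noiseProj g) := by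
  have hpsd : S.noiseCov.PosSemidef := by
    have := Matrix.posSemidef_conjTranspose_mul_self S.noiseCov
    rwa [noiseCov_isHermitian.eq, h.noiseCov_mul_self] at this
  have hsqrt : CFC.sqrt (S.σp ^ 2 • S.noiseCov) = S.σp • S.noiseCov := by
    apply CFC.sqrt_unique
    · rw [smul_mul_smul_comm, h.noiseCov_mul_self, sq]
    · exact (hpsd.smul h.σp_pos.le).nonneg
  unfold noiseLaw multivariateGaussian
  rw [hsqrt]
  simp [noiseProj]

end IsAdmissible

instance : IsProbabilityMeasure S.noiseLaw := by
  unfold noiseLaw; infer_instance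

namespace IsAdmissible

lemma measurable_scaled_noiseProj : Measurable (fun g => S.σp • S.noiseProj g) := by fun_prop

lemma ae_isNoise (h : S.IsAdmissible) : ∀ᵐ ξ ∂S.noiseLaw, S.IsNoise ξ := by
  have hm : MeasurableSet {ξ : Patch S.d | S.IsNoise ξ} := by
    have : {ξ : Patch S.d | S.IsNoise ξ} = ⋂ s : ℤˣ,
        ({ξ | inner ℝ (S.μ s) ξ = 0} ∩ {ξ | inner ℝ (S.ν s) ξ = 0}) := by
      ext ξ; simp [IsNoise]
    rw [this]
    refine MeasurableSet.iInter fun s => MeasurableSet.inter ?_ ?_ <;>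
    · apply measurableSet_eq_fun <;> fun_prop
  rw [h.noiseLaw_eq_map, ae_map_iff measurable_scaled_noiseProj.aemeasurable hm]
  refine ae_of_all _ fun g s => ?_
  have := h.isNoise_noiseProj g s
  simp [real_inner_smul_right, this.1, this.2]

lemma noiseLaw_inner_ge_le (h : S.IsAdmissible) (v : Patch S.d) {V r : ℝ} (hV : ‖v‖ ^ 2 ≤ V)
    (hr : 0 ≤ r) : S.noiseLaw {ξ | r ≤ inner ℝ v ξ} ≤
      ENNReal.ofReal (Real.exp (-(r ^ 2 / (2 * (S.σp ^ 2 * V))))) := by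
  rw [h.noiseLaw_eq_map, Measure.map_apply measurable_scaled_noiseProj
    (measurableSet_le measurable_const (by fun_prop))]
  have e : (fun g => S.σp • S.noiseProj g) ⁻¹' {ξ | r ≤ inner ℝ v ξ} =
      {g | r ≤ inner ℝ (S.σp • S.noiseProj v) g} := by
    ext g
    simp only [Set.mem_preimage, Set.mem_ofPred_eq, real_inner_smul_left, real_inner_smul_right,
      inner_noiseProj_left]
  rw [e]
  refine stdGaussian_inner_ge_le _ ?_ hr
  rw [norm_smul, mul_pow, Real.norm_eq_abs, sq_abs]
  exact mul_le_mul_of_nonneg_left ((h.norm_noiseProj_sq_le v).trans hV) (sq_nonneg _)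

lemma noiseLaw_abs_inner_ge_le (h : S.IsAdmissible) (v : Patch S.d) {V r : ℝ} (hV : ‖v‖ ^ 2 ≤ V)
    (hr : 0 ≤ r) : S.noiseLaw {ξ | r ≤ |inner ℝ v ξ|} ≤
      2 * ENNReal.ofReal (Real.exp (-(r ^ 2 / (2 * (S.σp ^ 2 * V))))) := by
  have h1 := h.noiseLaw_inner_ge_le v hV hr
  have h2 := h.noiseLaw_inner_ge_le (-v) (V := V) (by rwa [norm_neg]) hr
  rw [two_mul]
  refine le_trans ?_ ((measure_union_le _ _).trans (add_le_add h1 h2))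
  apply measure_mono
  intro g hg
  rw [Set.mem_ofPred_eq] at hg
  rcases le_abs.1 hg with h | h
  · exact Or.inl h
  · exact Or.inr (by simpa [inner_neg_left] using h)

lemma noiseLaw_norm_upper (h : S.IsAdmissible) :
    S.noiseLaw {ξ | 4 * (S.σp ^ 2 * S.d) < ‖ξ‖ ^ 2} ≤
      ENNReal.ofReal (Real.exp (-((S.d : ℝ) / 160))) := by
  rw [h.noiseLaw_eq_map, Measure.map_apply measurable_scaled_noiseProj
    (measurableSet_lt measurable_const (by fun_prop))]
  refine le_trans (measure_mono ?_) (stdGaussian_norm_sq_ge_le S.d)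
  intro g hg
  simp only [Set.mem_preimage, Set.mem_ofPred_eq, norm_smul, mul_pow, Real.norm_eq_abs,
    sq_abs] at hg
  have hσ := pow_pos h.σp_pos 2
  have h1 : 4 * (S.d : ℝ) < ‖S.noiseProj g‖ ^ 2 := by
    by_contra hcon
    have := mul_le_mul_of_nonneg_left (not_lt.1 hcon) hσ.le
    linarith
  exact h1.le.trans (h.norm_noiseProj_sq_le g)

/-- The projection removes four squared Gaussian coordinates. Unless `‖g‖² ≤ d / 4` or one of them
reaches `d / 80`, what remains is at least `d / 4 - 4 * d / 80 = d / 5`. The count is `9 = 1 + 4 *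
2`, the coordinate tails being two-sided. -/
lemma noiseLaw_norm_lower (h : S.IsAdmissible) :
    S.noiseLaw {ξ | ‖ξ‖ ^ 2 < S.σp ^ 2 * S.d / 5} ≤
      9 * ENNReal.ofReal (Real.exp (-((S.d : ℝ) / 160))) := by
  rw [h.noiseLaw_eq_map, Measure.map_apply measurable_scaled_noiseProj
    (measurableSet_lt (by fun_prop) measurable_const)]
  set q := ENNReal.ofReal (Real.exp (-((S.d : ℝ) / 160))) with hq
  set r := Real.sqrt ((S.d : ℝ) / 80) with hr
  have hr2 : r ^ 2 = (S.d : ℝ) / 80 := Real.sq_sqrt (by positivity)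
  have tail : ∀ u : Patch S.d, ‖u‖ ^ 2 ≤ 1 →
      stdGaussian (Patch S.d) {g | r ≤ |inner ℝ u g|} ≤ 2 * q := by
    intro u hu
    refine (stdGaussian_abs_inner_ge_le u hu (Real.sqrt_nonneg _)).trans (le_of_eq ?_)
    rw [hr2, hq]
    congr 4
    ring
  have nμ : ∀ s, ‖S.normμ⁻¹ • S.μ s‖ ^ 2 ≤ 1 := by
    intro s
    rw [norm_smul, h.norm_μ, norm_inv, Real.norm_of_nonneg h.normμ_pos.le,
      inv_mul_cancel₀ h.normμ_pos.ne']
    norm_num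
  have nν : ∀ s, ‖S.normν⁻¹ • S.ν s‖ ^ 2 ≤ 1 := by
    intro s
    rw [norm_smul, h.norm_ν, norm_inv, Real.norm_of_nonneg h.normν_pos.le,
      inv_mul_cancel₀ h.normν_pos.ne']
    norm_num
  have cover : (fun g => S.σp • S.noiseProj g) ⁻¹' {ξ | ‖ξ‖ ^ 2 < S.σp ^ 2 * S.d / 5} ⊆
      {g | ‖g‖ ^ 2 ≤ (S.d : ℝ) / 4} ∪ ((⋃ s : ℤˣ, {g | r ≤ |inner ℝ (S.normμ⁻¹ • S.μ s) g|}) ∪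
        (⋃ s : ℤˣ, {g | r ≤ |inner ℝ (S.normν⁻¹ • S.ν s) g|})) := by
    intro g hg
    simp only [Set.mem_preimage, Set.mem_ofPred_eq, norm_smul, mul_pow, Real.norm_eq_abs,
      sq_abs] at hg
    by_contra hcon
    simp only [Set.mem_union, Set.mem_iUnion, Set.mem_ofPred_eq, not_or, not_exists, not_le] at hcon
    obtain ⟨c1, c2, c3⟩ := hcon
    have hσ := pow_pos h.σp_pos 2
    have hlt : ∀ x : ℝ, |x| < r → x ^ 2 ≤ (S.d : ℝ) / 80 := by
      intro x hx
      rw [← hr2, ← sq_abs x]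
      exact pow_le_pow_left₀ (abs_nonneg _) hx.le 2
    have s1 := Finset.sum_le_sum fun (s : ℤˣ) (_ : s ∈ Finset.univ) => hlt _ (c2 s)
    have s2 := Finset.sum_le_sum fun (s : ℤˣ) (_ : s ∈ Finset.univ) => hlt _ (c3 s)
    simp only [Finset.sum_const, Finset.card_univ, Fintype.card_units_int, nsmul_eq_mul] at s1 s2
    have : (S.d : ℝ) / 5 ≤ ‖S.noiseProj g‖ ^ 2 := by
      rw [h.norm_noiseProj_sq]
      push_cast at s1 s2
      linarith
    have := mul_le_mul_of_nonneg_left this hσ.le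
    linarith
  refine (measure_mono cover).trans ?_
  have u1 : stdGaussian (Patch S.d) (⋃ s : ℤˣ, {g | r ≤ |inner ℝ (S.normμ⁻¹ • S.μ s) g|}) ≤
      4 * q := by
    refine (measure_iUnion_fintype_le _ _).trans ?_
    refine (Finset.sum_le_sum fun s _ => tail _ (nμ s)).trans (le_of_eq ?_)
    simp only [Finset.sum_const, Finset.card_univ, Fintype.card_units_int, nsmul_eq_mul]
    push_cast
    ring
  have u2 : stdGaussian (Patch S.d) (⋃ s : ℤˣ, {g | r ≤ |inner ℝ (S.normν⁻¹ • S.ν s) g|}) ≤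
      4 * q := by
    refine (measure_iUnion_fintype_le _ _).trans ?_
    refine (Finset.sum_le_sum fun s _ => tail _ (nν s)).trans (le_of_eq ?_)
    simp only [Finset.sum_const, Finset.card_univ, Fintype.card_units_int, nsmul_eq_mul]
    push_cast
    ring
  refine (measure_union_le _ _).trans ((add_le_add (stdGaussian_norm_sq_le_le S.d)
    ((measure_union_le _ _).trans (add_le_add u1 u2))).trans (le_of_eq ?_))
  rw [← hq]
  ring

end IsAdmissible

end Setting

/-! ### Hoeffding's inequality for i.i.d. samples in `[0, 2]`. -/

lemma hoeffding_pi {Ω : Type*} [MeasurableSpace Ω] (μ : Measure Ω) [IsProbabilityMeasure μ] (n : ℕ)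
    {φ : Ω → ℝ} (hφ : Measurable φ) (h : ∀ᵐ x ∂μ, φ x ∈ Set.Icc (0 : ℝ) 2) {τ : ℝ} (hτ : 0 ≤ τ) :
    Measure.pi (fun _ : Fin n => μ) {x | n * (∫ ω, φ ω ∂μ + τ) ≤ ∑ i, φ (x i)} ≤
      ENNReal.ofReal (Real.exp (-(n * τ ^ 2 / 2))) := by
  rcases Nat.eq_zero_or_pos n with hn | hn
  · subst hn
    simp
  have hind : iIndepFun (fun (i : Fin n) (x : Fin n → Ω) => φ (x i) - ∫ ω, φ ω ∂μ)
      (Measure.pi (fun _ : Fin n => μ)) :=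
    iIndepFun_pi (X := fun _ ω => φ ω - ∫ ω, φ ω ∂μ) (fun i => (hφ.sub_const _).aemeasurable)
  have hsub : ∀ i : Fin n, HasSubgaussianMGF (fun (x : Fin n → Ω) => φ (x i) - ∫ ω, φ ω ∂μ) 1
      (Measure.pi (fun _ : Fin n => μ)) := by
    intro i
    have h1 := hasSubgaussianMGF_of_mem_Icc hφ.aemeasurable h
    have h2 : ((‖(2 : ℝ) - 0‖₊ / 2) ^ 2 : NNReal) = 1 := by
      ext; norm_num
    rw [h2] at h1
    have h3 : HasSubgaussianMGF (fun x => φ x - ∫ ω, φ ω ∂μ) 1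
        ((Measure.pi (fun _ : Fin n => μ)).map (Function.eval i)) := by
      rwa [(measurePreserving_eval (fun _ : Fin n => μ) i).map_eq]
    exact HasSubgaussianMGF.of_map (μ := Measure.pi (fun _ : Fin n => μ)) (Y := Function.eval i)
      (X := fun x => φ x - ∫ ω, φ ω ∂μ) (measurable_pi_apply i).aemeasurable h3
  have key := HasSubgaussianMGF.measure_sum_ge_le_of_iIndepFun hind (s := Finset.univ)
    (c := fun _ => 1) (fun i _ => hsub i) (ε := n * τ) (by positivity)
  rw [← ENNReal.ofReal_toReal (measure_ne_top (Measure.pi _) _)]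
  apply ENNReal.ofReal_le_ofReal
  have e : {x : Fin n → Ω | n * (∫ ω, φ ω ∂μ + τ) ≤ ∑ i, φ (x i)} =
      {x | n * τ ≤ ∑ i, (φ (x i) - ∫ ω, φ ω ∂μ)} := by
    ext x
    simp only [Set.mem_ofPred_eq, Finset.sum_sub_distrib, Finset.sum_const, Finset.card_univ,
      Fintype.card_fin, nsmul_eq_mul, mul_add, le_sub_iff_add_le']
  rw [e]
  refine key.trans (le_of_eq ?_)
  congr 1
  have : (0 : ℝ) < n := by exact_mod_cast hn
  simp
  field_simp

lemma hoeffding_pi_lower {Ω : Type*} [MeasurableSpace Ω] (μ : Measure Ω) [IsProbabilityMeasure μ]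
    (n : ℕ) {φ : Ω → ℝ} (hφ : Measurable φ) (h : ∀ᵐ x ∂μ, φ x ∈ Set.Icc (0 : ℝ) 2) {τ : ℝ}
    (hτ : 0 ≤ τ) :
    Measure.pi (fun _ : Fin n => μ) {x | ∑ i, φ (x i) ≤ n * (∫ ω, φ ω ∂μ - τ)} ≤
      ENNReal.ofReal (Real.exp (-(n * τ ^ 2 / 2))) := by
  have hint : Integrable φ μ := Integrable.of_mem_Icc 0 2 hφ.aemeasurable h
  have key := hoeffding_pi μ n (φ := fun ω => 2 - φ ω) (hφ.const_sub 2)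
    (h.mono fun x hx => ⟨by linarith [hx.2], by linarith [hx.1]⟩) hτ
  rw [integral_sub (integrable_const _) hint] at key
  refine le_trans (measure_mono fun x hx => ?_) key
  simp only [Set.mem_ofPred_eq, Finset.sum_sub_distrib, Finset.sum_const, Finset.card_univ,
      Fintype.card_fin, nsmul_eq_mul, integral_const, probReal_univ, one_smul] at hx ⊢
  linarith

/-! ### Shuffled inputs, measurability and the discrete mixture. -/

lemma patchSum_shuffledInput {d : ℕ} (v : Patch d × Patch d) (ξ : Patch d)
    (π : Equiv.Perm (Fin 3)) : patchSum (shuffledInput v ξ π) = v.1 + v.2 + ξ := by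
  unfold patchSum shuffledInput
  rw [Equiv.sum_comp π (![v.1, v.2, ξ] : Fin 3 → Patch d), Fin.sum_univ_three]
  rfl

lemma measurable_shuffledInput {d : ℕ} (v : Patch d × Patch d) (π : Equiv.Perm (Fin 3)) (y : ℤˣ) :
    Measurable (fun ξ : Patch d => ((shuffledInput v ξ π, y) : DataPoint d)) := by
  refine Measurable.prodMk ?_ measurable_const
  refine measurable_pi_lambda _ fun p => ?_
  unfold shuffledInput
  generalize π p = q
  fin_cases q
  · exact measurable_const
  · exact measurable_const
  · exact measurable_id

lemma measurable_patchSum {d : ℕ} :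
    Measurable (patchSum : (Fin 3 → Patch d) → Patch d) := by
  unfold patchSum; fun_prop

instance : MeasurableSingletonClass ℤˣ :=
  ⟨fun u => ⟨{(u : ℤ)}, measurableSet_singleton _, by ext; simp [Units.ext_iff]⟩⟩

namespace Setting

variable {S : Setting}

lemma measurable_μ_label : Measurable (fun z : DataPoint S.d => S.μ z.2) :=
  (measurable_of_finite S.μ).comp measurable_snd

lemma measurable_ν_label : Measurable (fun z : DataPoint S.d => S.ν z.2) :=
  (measurable_of_finite S.ν).comp measurable_snd

lemma measurable_easyCoeff : Measurable S.easyCoeff := by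
  unfold easyCoeff
  exact (measurable_μ_label.inner (measurable_patchSum.comp measurable_fst)).div_const _

lemma measurable_hardCoeff : Measurable S.hardCoeff := by
  unfold hardCoeff
  exact (measurable_ν_label.inner (measurable_patchSum.comp measurable_fst)).div_const _

lemma measurable_noisePart : Measurable S.noisePart := by
  unfold noisePart
  exact ((measurable_patchSum.comp measurable_fst).sub
    (measurable_easyCoeff.smul measurable_μ_label)).sub
    (measurable_hardCoeff.smul measurable_ν_label)

lemma measurableSet_isRegular : MeasurableSet {z | S.IsRegular z} := by
  have : {z | S.IsRegular z} = (⋂ s : ℤˣ,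
      ({z | inner ℝ (S.μ s) (S.noisePart z) = 0} ∩ {z | inner ℝ (S.ν s) (S.noisePart z) = 0})) ∩
      ({z | 0 ≤ S.easyCoeff z} ∩ ({z | S.easyCoeff z ≤ 2} ∩ {z | |S.hardCoeff z| ≤ 2})) := by
    ext z
    simp only [Set.mem_ofPred_eq, Set.mem_inter_iff, Set.mem_iInter]
    exact ⟨fun h => ⟨h.isNoise, h.easyCoeff_nonneg, h.easyCoeff_le, h.abs_hardCoeff_le⟩,
      fun h => ⟨h.1, h.2.1, h.2.2.1, h.2.2.2⟩⟩
  rw [this]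
  refine (MeasurableSet.iInter fun s => MeasurableSet.inter ?_ ?_).inter
    (MeasurableSet.inter ?_ (MeasurableSet.inter ?_ ?_))
  · exact measurableSet_eq_fun (measurable_const.inner measurable_noisePart) measurable_const
  · exact measurableSet_eq_fun (measurable_const.inner measurable_noisePart) measurable_const
  · exact measurableSet_le measurable_const measurable_easyCoeff
  · exact measurableSet_le measurable_easyCoeff measurable_const
  · exact measurableSet_le (by simpa using measurable_hardCoeff.abs) measurable_const

section TypeLaw

variable {k : ℕ} {pairs : ℤˣ → Fin k → Patch S.d × Patch S.d}

lemma sum_choices_const (hk : 0 < k) (q : ℝ≥0∞) :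
    ∑ _y : ℤˣ, ∑ _j : Fin k, ∑ _π : Equiv.Perm (Fin 3), ((2 : ℝ≥0∞) * (k : ℝ≥0∞) * 6)⁻¹ * q
      = q := by
  simp only [Finset.sum_const, Finset.card_univ, Fintype.card_units_int, Fintype.card_fin,
    Fintype.card_perm, nsmul_eq_mul]
  have h6 : ((Nat.factorial 3 : ℕ) : ℝ≥0∞) = 6 := by norm_num [Nat.factorial]
  rw [h6]
  have hk' : (k : ℝ≥0∞) ≠ 0 := by exact_mod_cast hk.ne'
  have h0 : (2 : ℝ≥0∞) * k * 6 ≠ 0 := by simp [hk']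
  have ht : (2 : ℝ≥0∞) * k * 6 ≠ ⊤ := by finiteness
  calc _ = (2 * k * 6) * ((2 : ℝ≥0∞) * k * 6)⁻¹ * q := by push_cast; ring
    _ = q := by rw [ENNReal.mul_inv_cancel h0 ht, one_mul]

lemma typeLaw_apply {A : Set (DataPoint S.d)} (hA : MeasurableSet A) :
    S.typeLaw pairs A = ∑ y : ℤˣ, ∑ j : Fin k, ∑ π : Equiv.Perm (Fin 3),
      ((2 : ℝ≥0∞) * (k : ℝ≥0∞) * 6)⁻¹ *
        S.noiseLaw {ξ | (shuffledInput (pairs y j) ξ π, y) ∈ A} := by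
  simp only [typeLaw, Measure.coe_finsetSum, Finset.sum_apply, Measure.smul_apply, smul_eq_mul,
    Measure.map_apply (measurable_shuffledInput _ _ _) hA]
  rfl

lemma typeLaw_le (hk : 0 < k) {A : Set (DataPoint S.d)} (hA : MeasurableSet A) {q : ℝ≥0∞}
    (h : ∀ y j π, S.noiseLaw {ξ | (shuffledInput (pairs y j) ξ π, y) ∈ A} ≤ q) :
    S.typeLaw pairs A ≤ q := by
  rw [typeLaw_apply hA]
  refine le_trans ?_ (sum_choices_const hk q).le
  gcongr with y _ j _ π _
  exact h y j π

lemma typeLaw_eq (hk : 0 < k) {A : Set (DataPoint S.d)} (hA : MeasurableSet A) {q : ℝ≥0∞}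
    (h : ∀ y j π, S.noiseLaw {ξ | (shuffledInput (pairs y j) ξ π, y) ∈ A} = q) :
    S.typeLaw pairs A = q := by
  rw [typeLaw_apply hA]
  simp only [h]
  exact sum_choices_const hk q

/-- No measurability of `A` is required, so this applies to the supports of the data categories. -/
lemma le_typeLaw (hk : 0 < k) (A : Set (DataPoint S.d)) {q : ℝ≥0∞}
    (h : ∀ y j π, q ≤ S.noiseLaw {ξ | (shuffledInput (pairs y j) ξ π, y) ∈ A}) :
    q ≤ S.typeLaw pairs A := by
  simp only [typeLaw, Measure.coe_finsetSum, Finset.sum_apply, Measure.smul_apply, smul_eq_mul]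
  refine (sum_choices_const hk q).symm.le.trans ?_
  gcongr with y _ j _ π _
  exact (h y j π).trans
    (Measure.le_map_apply (measurable_shuffledInput _ _ _).aemeasurable _)

lemma isProbabilityMeasure_typeLaw (hk : 0 < k) : IsProbabilityMeasure (S.typeLaw pairs) :=
  ⟨typeLaw_eq hk MeasurableSet.univ fun y j π => by simp⟩

lemma integral_typeLaw {φ : DataPoint S.d → ℝ} (hφ : Measurable φ) {v : ℤˣ → Fin k → ℝ}
    (h : ∀ y j π, ∀ᵐ ξ ∂S.noiseLaw, φ (shuffledInput (pairs y j) ξ π, y) = v y j) :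
    Integrable φ (S.typeLaw pairs) ∧
      ∫ z, φ z ∂(S.typeLaw pairs) = (2 * k : ℝ)⁻¹ * ∑ y, ∑ j, v y j := by
  have hI : ∀ y j π, Integrable φ (((2 : ℝ≥0∞) * (k : ℝ≥0∞) * 6)⁻¹ •
      S.noiseLaw.map (fun ξ : Patch S.d => (shuffledInput (pairs y j) ξ π, y))) := by
    intro y j π
    refine Integrable.smul_measure ?_ ?_
    · rw [integrable_map_measure hφ.aestronglyMeasurable
        (measurable_shuffledInput _ _ _).aemeasurable]
      exact (integrable_const (v y j)).congr ((h y j π).mono fun ξ hξ => hξ.symm)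
    · have : 0 < k := Fin.pos j
      have hk' : (k : ℝ≥0∞) ≠ 0 := by exact_mod_cast this.ne'
      simp [hk']
  have hi : ∀ y j π, ∫ z, φ z ∂(((2 : ℝ≥0∞) * (k : ℝ≥0∞) * 6)⁻¹ •
      S.noiseLaw.map (fun ξ : Patch S.d => (shuffledInput (pairs y j) ξ π, y))) =
      (2 * k * 6 : ℝ)⁻¹ * v y j := by
    intro y j π
    rw [integral_smul_measure, integral_map (measurable_shuffledInput _ _ _).aemeasurable
      hφ.aestronglyMeasurable, integral_congr_ae (h y j π)]
    simp
  refine ⟨?_, ?_⟩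
  · unfold typeLaw
    exact integrable_finsetSum_measure.2 fun y _ => integrable_finsetSum_measure.2 fun j _ =>
      integrable_finsetSum_measure.2 fun π _ => hI y j π
  · unfold typeLaw
    rw [integral_finsetSum_measure fun y _ => integrable_finsetSum_measure.2 fun j _ =>
      integrable_finsetSum_measure.2 fun π _ => hI y j π]
    simp_rw [integral_finsetSum_measure fun j _ => integrable_finsetSum_measure.2 fun π _ =>
      hI _ j π, integral_finsetSum_measure fun π _ => hI _ _ π, hi]
    simp only [Finset.sum_const, Finset.card_univ, Fintype.card_perm, Fintype.card_fin,
      nsmul_eq_mul, Finset.mul_sum]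
    refine Finset.sum_congr rfl fun y _ => Finset.sum_congr rfl fun j _ => ?_
    have : (0 : ℝ) < k := by exact_mod_cast Fin.pos j
    norm_num [Nat.factorial]
    field_simp

end TypeLaw

end Setting

/-! ### Coefficients and expectations under the data distribution. -/

namespace Setting

variable {S : Setting}

/-- The signal pairs of a category have prescribed coefficients along the signals. -/
def HasCoeffs {k : ℕ} (S : Setting) (pairs : ℤˣ → Fin k → Patch S.d × Patch S.d)
    (c b : Fin k → ℝ) : Prop :=
  ∀ y j, (pairs y j).1 + (pairs y j).2 = c j • S.μ y + b j • S.ν y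

lemma hasCoeffs_easyPairs : S.HasCoeffs S.easyPairs (fun _ => 2) (fun _ => 0) := by
  intro y j
  simp [easyPairs, two_smul]

lemma hasCoeffs_hardPairs : S.HasCoeffs S.hardPairs (fun _ => 0) ![2, 0, 0, -2] := by
  intro y j
  fin_cases j <;> simp [hardPairs, two_smul]

lemma hasCoeffs_bothPairs : S.HasCoeffs S.bothPairs (fun _ => 1) ![1, -1, 1, -1] := by
  intro y j
  fin_cases j <;> simp [bothPairs, add_comm]

namespace IsAdmissible

lemma coeffs_of_patchSum (h : S.IsAdmissible) {z : DataPoint S.d} {c b : ℝ} {ξ : Patch S.d}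
    (hξ : S.IsNoise ξ) (hz : patchSum z.1 = c • S.μ z.2 + b • S.ν z.2 + ξ) :
    S.easyCoeff z = c ∧ S.hardCoeff z = b ∧ S.noisePart z = ξ := by
  have hμ := (pow_pos h.normμ_pos 2).ne'
  have hν := (pow_pos h.normν_pos 2).ne'
  have h1 : S.easyCoeff z = c := by
    rw [easyCoeff, hz, div_eq_iff hμ]
    simp [inner_add_right, real_inner_smul_right, h.μ_ν_orthogonal, (hξ z.2).1,
      h.norm_μ]
  have h2 : S.hardCoeff z = b := by
    rw [hardCoeff, hz, div_eq_iff hν]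
    simp [inner_add_right, real_inner_smul_right, h.inner_ν_μ, (hξ z.2).2,
      h.norm_ν]
  refine ⟨h1, h2, ?_⟩
  rw [noisePart, h1, h2, hz]
  abel

lemma coeffs_shuffledInput (h : S.IsAdmissible) {k : ℕ}
    {pairs : ℤˣ → Fin k → Patch S.d × Patch S.d} {c b : Fin k → ℝ}
    (hp : S.HasCoeffs pairs c b) (y : ℤˣ) (j : Fin k) (π : Equiv.Perm (Fin 3)) {ξ : Patch S.d}
    (hξ : S.IsNoise ξ) :
    S.easyCoeff (shuffledInput (pairs y j) ξ π, y) = c j ∧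
      S.hardCoeff (shuffledInput (pairs y j) ξ π, y) = b j ∧
      S.noisePart (shuffledInput (pairs y j) ξ π, y) = ξ := by
  refine h.coeffs_of_patchSum hξ ?_
  rw [patchSum_shuffledInput, hp y j]

lemma typeLaw_isRegular (h : S.IsAdmissible) {k : ℕ} (hk : 0 < k)
    {pairs : ℤˣ → Fin k → Patch S.d × Patch S.d} {c b : Fin k → ℝ}
    (hp : S.HasCoeffs pairs c b) (hc : ∀ j, 0 ≤ c j ∧ c j ≤ 2) (hb : ∀ j, |b j| ≤ 2) :
    S.typeLaw pairs {z | S.IsRegular z}ᶜ = 0 := by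
  refine typeLaw_eq hk measurableSet_isRegular.compl fun y j π => ?_
  refine measure_mono_null ?_ h.ae_isNoise
  intro ξ hξ hn
  obtain ⟨h1, h2, h3⟩ := h.coeffs_shuffledInput hp y j π hn
  exact hξ ⟨by rwa [h3], by rw [h1]; exact (hc j).1, by rw [h1]; exact (hc j).2,
    by rw [h2]; exact hb j⟩

lemma typeLaw_noisePart (h : S.IsAdmissible) {k : ℕ} (hk : 0 < k)
    {pairs : ℤˣ → Fin k → Patch S.d × Patch S.d} {c b : Fin k → ℝ}
    (hp : S.HasCoeffs pairs c b) {A : Set (Patch S.d)} (hA : MeasurableSet A) :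
    S.typeLaw pairs (S.noisePart ⁻¹' A) = S.noiseLaw A := by
  refine typeLaw_eq hk (measurable_noisePart hA) fun y j π => measure_congr ?_
  filter_upwards [h.ae_isNoise] with ξ hξ
  have := (h.coeffs_shuffledInput hp y j π hξ).2.2
  change (S.noisePart (shuffledInput (pairs y j) ξ π, y) ∈ A) = (ξ ∈ A)
  rw [this]

lemma integral_typeLaw_coeffs (h : S.IsAdmissible) {k : ℕ}
    {pairs : ℤˣ → Fin k → Patch S.d × Patch S.d} {c b : Fin k → ℝ}
    (hp : S.HasCoeffs pairs c b) {G : ℤˣ → ℝ → ℝ → ℝ}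
    (hG : Measurable fun z : DataPoint S.d => G z.2 (S.easyCoeff z) (S.hardCoeff z)) :
    Integrable (fun z => G z.2 (S.easyCoeff z) (S.hardCoeff z)) (S.typeLaw pairs) ∧
    ∫ z, G z.2 (S.easyCoeff z) (S.hardCoeff z) ∂(S.typeLaw pairs) =
      (2 * k : ℝ)⁻¹ * ∑ y, ∑ j, G y (c j) (b j) := by
  refine integral_typeLaw hG fun y j π => ?_
  filter_upwards [h.ae_isNoise] with ξ hξ
  obtain ⟨h1, h2, -⟩ := h.coeffs_shuffledInput hp y j π hξ
  rw [h1, h2]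

lemma weights_sum (h : S.IsAdmissible) :
    ENNReal.ofReal S.pe + ENNReal.ofReal S.ph + ENNReal.ofReal S.pb = 1 := by
  rw [← ENNReal.ofReal_add h.pe_pos.le h.ph_pos.le,
    ← ENNReal.ofReal_add (add_nonneg h.pe_pos.le h.ph_pos.le) h.pb_pos.le, h.p_sum,
    ENNReal.ofReal_one]

lemma dataLaw_apply (A : Set (DataPoint S.d)) :
    S.dataLaw A = ENNReal.ofReal S.pe * S.typeLaw S.easyPairs A +
      ENNReal.ofReal S.ph * S.typeLaw S.hardPairs A +
      ENNReal.ofReal S.pb * S.typeLaw S.bothPairs A := by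
  simp [dataLaw]

lemma isProbabilityMeasure_dataLaw (h : S.IsAdmissible) : IsProbabilityMeasure S.dataLaw := by
  have h1 := isProbabilityMeasure_typeLaw (S := S) (pairs := S.easyPairs) one_pos
  have h2 := isProbabilityMeasure_typeLaw (S := S) (pairs := S.hardPairs) four_pos
  have h3 := isProbabilityMeasure_typeLaw (S := S) (pairs := S.bothPairs) four_pos
  constructor
  rw [dataLaw_apply, measure_univ, measure_univ, measure_univ, mul_one, mul_one, mul_one,
    h.weights_sum]

lemma ae_isRegular (h : S.IsAdmissible) : ∀ᵐ z ∂S.dataLaw, S.IsRegular z := by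
  change S.dataLaw {z | S.IsRegular z}ᶜ = 0
  rw [dataLaw_apply, h.typeLaw_isRegular one_pos hasCoeffs_easyPairs (by intro j; norm_num)
    (by intro j; norm_num), h.typeLaw_isRegular four_pos hasCoeffs_hardPairs
    (by intro j; norm_num) (by intro j; fin_cases j <;> norm_num),
    h.typeLaw_isRegular four_pos hasCoeffs_bothPairs (by intro j; norm_num)
    (by intro j; fin_cases j <;> norm_num)]
  simp

lemma map_noisePart (h : S.IsAdmissible) : S.dataLaw.map S.noisePart = S.noiseLaw := by
  ext A hA
  rw [Measure.map_apply measurable_noisePart hA, dataLaw_apply,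
    h.typeLaw_noisePart one_pos hasCoeffs_easyPairs hA,
    h.typeLaw_noisePart four_pos hasCoeffs_hardPairs hA,
    h.typeLaw_noisePart four_pos hasCoeffs_bothPairs hA, ← add_mul, ← add_mul, h.weights_sum,
    one_mul]

lemma integral_dataLaw (h : S.IsAdmissible) {G : ℤˣ → ℝ → ℝ → ℝ}
    (hG : Measurable fun z : DataPoint S.d => G z.2 (S.easyCoeff z) (S.hardCoeff z)) :
    ∫ z, G z.2 (S.easyCoeff z) (S.hardCoeff z) ∂S.dataLaw =
      S.pe * (2⁻¹ * ∑ y, G y 2 0) +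
      S.ph * (8⁻¹ * ∑ y, (G y 0 2 + G y 0 0 + G y 0 0 + G y 0 (-2))) +
      S.pb * (8⁻¹ * ∑ y, (G y 1 1 + G y 1 (-1) + G y 1 1 + G y 1 (-1))) := by
  obtain ⟨i1, e1⟩ := h.integral_typeLaw_coeffs hasCoeffs_easyPairs hG
  obtain ⟨i2, e2⟩ := h.integral_typeLaw_coeffs hasCoeffs_hardPairs hG
  obtain ⟨i3, e3⟩ := h.integral_typeLaw_coeffs hasCoeffs_bothPairs hG
  have j1 := i1.smul_measure (ENNReal.ofReal_ne_top (r := S.pe))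
  have j2 := i2.smul_measure (ENNReal.ofReal_ne_top (r := S.ph))
  have j3 := i3.smul_measure (ENNReal.ofReal_ne_top (r := S.pb))
  rw [dataLaw, integral_add_measure (j1.add_measure j2) j3, integral_add_measure j1 j2,
    integral_smul_measure, integral_smul_measure, integral_smul_measure, e1, e2, e3,
    ENNReal.toReal_ofReal h.pe_pos.le, ENNReal.toReal_ofReal h.ph_pos.le,
    ENNReal.toReal_ofReal h.pb_pos.le]
  simp only [Fin.sum_univ_four, smul_eq_mul]
  norm_num
  rfl

lemma integral_easyCoeff (h : S.IsAdmissible) :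
    ∫ z, S.easyCoeff z ∂S.dataLaw = 2 * S.pe + S.pb := by
  rw [h.integral_dataLaw (G := fun _ c _ => c) measurable_easyCoeff]
  simp only [Finset.sum_const, Finset.card_univ, Fintype.card_units_int, nsmul_eq_mul]
  push_cast
  ring

lemma integral_abs_hardCoeff (h : S.IsAdmissible) :
    ∫ z, |S.hardCoeff z| ∂S.dataLaw = S.ph + S.pb := by
  rw [h.integral_dataLaw (G := fun _ _ b => |b|) (by simpa using measurable_hardCoeff.abs)]
  simp only [Finset.sum_const, Finset.card_univ, Fintype.card_units_int, nsmul_eq_mul]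
  norm_num

lemma measurable_labelled_easyCoeff (y : ℤˣ) :
    Measurable fun z : DataPoint S.d => if z.2 = y then S.easyCoeff z else 0 :=
  Measurable.ite (measurable_snd (measurableSet_singleton y)) measurable_easyCoeff measurable_const

lemma integral_labelled_easyCoeff (h : S.IsAdmissible) (y : ℤˣ) :
    ∫ z, (if z.2 = y then S.easyCoeff z else 0) ∂S.dataLaw = (2 * S.pe + S.pb) / 2 := by
  rw [h.integral_dataLaw (G := fun y' c _ => if y' = y then c else 0)
    (measurable_labelled_easyCoeff y)]
  simp only [Finset.sum_add_distrib, Finset.sum_ite_eq', Finset.mem_univ, if_true]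
  ring

end IsAdmissible

end Setting

/-! ### The conditional test error. -/

namespace Setting

variable {S : Setting}

lemma measurable_labelSign : Measurable labelSign := measurable_of_finite _

lemma measurableSet_misclassified (w : Patch S.d) :
    MeasurableSet {z : DataPoint S.d | labelSign z.2 * weakModel w z.1 < 0} := by
  refine measurableSet_lt ?_ measurable_const
  simp_rw [weakModel_eq_inner]
  exact (measurable_labelSign.comp measurable_snd).mul
    (measurable_const.inner (measurable_patchSum.comp measurable_fst))

namespace IsAdmissible

lemma typeSupport_easyCoeff (h : S.IsAdmissible) {k : ℕ}
    {pairs : ℤˣ → Fin k → Patch S.d × Patch S.d} {c b : Fin k → ℝ}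
    (hp : S.HasCoeffs pairs c b) (hc : ∀ j, 1 ≤ c j) {z : DataPoint S.d}
    (hz : z ∈ S.typeSupport pairs) : S.easyCoeff z ≠ 0 := by
  obtain ⟨j, π, ξ, hξ, e⟩ := hz
  have h1 := (h.coeffs_shuffledInput hp z.2 j π hξ).1
  rw [← e] at h1
  change S.easyCoeff z = c j at h1
  rw [h1]
  exact (lt_of_lt_of_le one_pos (hc j)).ne'

lemma one_le_typeLaw_typeSupport (h : S.IsAdmissible) {k : ℕ} (hk : 0 < k)
    {pairs : ℤˣ → Fin k → Patch S.d × Patch S.d} :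
    1 ≤ S.typeLaw pairs (S.typeSupport pairs) := by
  refine le_typeLaw hk _ fun y j π => ?_
  have : ∀ᵐ ξ ∂S.noiseLaw, ξ ∈ {ξ | (shuffledInput (pairs y j) ξ π, y) ∈ S.typeSupport pairs} := by
    filter_upwards [h.ae_isNoise] with ξ hξ
    exact ⟨j, π, ξ, hξ, rfl⟩
  exact (measure_univ (μ := S.noiseLaw)).symm.le.trans (measure_mono_ae (this.mono fun ξ h _ => h))

/-- An error forces the noise term to outweigh the signal margin `m`. On noise vectors `w` acts like
`v`, so this is a one-sided Gaussian tail with variance at most `σp² V`. -/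
lemma typeLaw_misclassified_le (h : S.IsAdmissible) {k : ℕ} (hk : 0 < k)
    {pairs : ℤˣ → Fin k → Patch S.d × Patch S.d} {c b : Fin k → ℝ}
    (hp : S.HasCoeffs pairs c b) (hc : ∀ j, 1 ≤ c j) (hb : ∀ j, |b j| ≤ 1)
    {w v : Patch S.d} {m V : ℝ} (hm : 0 ≤ m)
    (hmargin : ∀ y (c b : ℝ), 1 ≤ c → |b| ≤ 1 →
      m ≤ labelSign y * inner ℝ w (c • S.μ y + b • S.ν y))
    (hv : ∀ ξ, S.IsNoise ξ → inner ℝ w ξ = inner ℝ v ξ) (hV : ‖v‖ ^ 2 ≤ V) :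
    S.typeLaw pairs {z | labelSign z.2 * weakModel w z.1 < 0} ≤
      ENNReal.ofReal (Real.exp (-(m ^ 2 / (2 * (S.σp ^ 2 * V))))) := by
  refine typeLaw_le hk (measurableSet_misclassified w) fun y j π => ?_
  have hV' : ‖-(labelSign y • v)‖ ^ 2 ≤ V := by
    rw [norm_neg, norm_smul, Real.norm_eq_abs, abs_labelSign, one_mul]; exact hV
  refine le_trans (measure_mono_ae ?_) (h.noiseLaw_inner_ge_le (-(labelSign y • v)) hV' hm)
  filter_upwards [h.ae_isNoise] with ξ hξ hlt
  have hlt : labelSign y * weakModel w (shuffledInput (pairs y j) ξ π) < 0 := hlt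
  change m ≤ inner ℝ (-(labelSign y • v)) ξ
  rw [weakModel_eq_inner, patchSum_shuffledInput, hp y j, inner_add_right, mul_add,
    hv ξ hξ] at hlt
  rw [inner_neg_left, real_inner_smul_left]
  linarith [hmargin y (c j) (b j) (hc j) (hb j)]

lemma condTestError_le (h : S.IsAdmissible) {w v : Patch S.d} {m V : ℝ} (hm : 0 ≤ m)
    (hmargin : ∀ y (c b : ℝ), 1 ≤ c → |b| ≤ 1 →
      m ≤ labelSign y * inner ℝ w (c • S.μ y + b • S.ν y))
    (hv : ∀ ξ, S.IsNoise ξ → inner ℝ w ξ = inner ℝ v ξ) (hV : ‖v‖ ^ 2 ≤ V) :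
    S.condTestError w ≤ ENNReal.ofReal (Real.exp (-(m ^ 2 / (2 * (S.σp ^ 2 * V))))) := by
  set q := ENNReal.ofReal (Real.exp (-(m ^ 2 / (2 * (S.σp ^ 2 * V))))) with hq
  set A := {z : DataPoint S.d | labelSign z.2 * weakModel w z.1 < 0} with hA
  have mA : MeasurableSet A := measurableSet_misclassified w
  -- The measurable set `N` stands in for `S_e ∪ S_b`: it contains both supports and is null for
  -- hard-only data, whose easy coefficient vanishes almost surely.
  set N := {z : DataPoint S.d | S.easyCoeff z ≠ 0} with hN
  have mN : MeasurableSet N :=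
    (measurableSet_eq_fun measurable_easyCoeff measurable_const).compl
  have hbb : ∀ j, |(![1, -1, 1, -1] : Fin 4 → ℝ) j| ≤ 1 := by
    intro j; fin_cases j <;> norm_num
  have t1 : S.typeLaw S.easyPairs (A ∩ N) ≤ q := (measure_mono Set.inter_subset_left).trans
    (h.typeLaw_misclassified_le one_pos hasCoeffs_easyPairs (by intro j; norm_num)
      (by intro j; norm_num) hm hmargin hv hV)
  have t3 : S.typeLaw S.bothPairs (A ∩ N) ≤ q := (measure_mono Set.inter_subset_left).trans
    (h.typeLaw_misclassified_le four_pos hasCoeffs_bothPairs (by intro j; norm_num)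
      hbb hm hmargin hv hV)
  have t2 : S.typeLaw S.hardPairs (A ∩ N) = 0 := by
    refine measure_mono_null Set.inter_subset_right ?_
    refine typeLaw_eq four_pos mN fun y j π => measure_mono_null ?_ h.ae_isNoise
    intro ξ hξ hn
    exact hξ (h.coeffs_shuffledInput hasCoeffs_hardPairs y j π hn).1
  have sub : (S.easyData ∪ S.bothData) ∩ A ⊆ A ∩ N := by
    rintro z ⟨hz | hz, hzA⟩
    · exact ⟨hzA, h.typeSupport_easyCoeff hasCoeffs_easyPairs (by intro j; norm_num) hz⟩
    · exact ⟨hzA, h.typeSupport_easyCoeff hasCoeffs_bothPairs (by intro j; norm_num) hz⟩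
  have up : S.dataLaw ((S.easyData ∪ S.bothData) ∩ A) ≤
      (ENNReal.ofReal S.pe + ENNReal.ofReal S.pb) * q := by
    refine (measure_mono sub).trans ?_
    rw [dataLaw_apply, t2, mul_zero, add_zero, add_mul]
    gcongr
  have lower : ENNReal.ofReal S.pe + ENNReal.ofReal S.pb ≤
      S.dataLaw (S.easyData ∪ S.bothData) := by
    rw [dataLaw_apply]
    have l1 : 1 ≤ S.typeLaw S.easyPairs (S.easyData ∪ S.bothData) :=
      (h.one_le_typeLaw_typeSupport one_pos).trans (measure_mono Set.subset_union_left)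
    have l3 : 1 ≤ S.typeLaw S.bothPairs (S.easyData ∪ S.bothData) :=
      (h.one_le_typeLaw_typeSupport four_pos).trans (measure_mono Set.subset_union_right)
    refine add_le_add (le_add_right ?_) ?_
    · simpa using mul_le_mul_right l1 (ENNReal.ofReal S.pe)
    · simpa using mul_le_mul_right l3 (ENNReal.ofReal S.pb)
  have : IsProbabilityMeasure S.dataLaw := h.isProbabilityMeasure_dataLaw
  have hpos : S.dataLaw (S.easyData ∪ S.bothData) ≠ 0 := by
    refine (lt_of_lt_of_le ?_ lower).ne'
    exact add_pos_of_pos_of_nonneg (ENNReal.ofReal_pos.2 h.pe_pos) zero_le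
  unfold condTestError
  rw [cond_apply' mA]
  calc _ ≤ (S.dataLaw (S.easyData ∪ S.bothData))⁻¹ *
        (S.dataLaw (S.easyData ∪ S.bothData) * q) := by
        gcongr
        exact up.trans (by gcongr)
    _ = q := by
      rw [← mul_assoc, ENNReal.inv_mul_cancel hpos (measure_ne_top _ _), one_mul]

lemma condTestError_zero : S.condTestError 0 = 0 := by
  unfold condTestError
  have : {z : DataPoint S.d | labelSign z.2 * weakModel 0 z.1 < 0} = ∅ := by
    ext z; simp [weakModel]
  rw [this, measure_empty]

end IsAdmissible

lemma inner_sum_eq_noiseSum {train : Fin S.nwk → DataPoint S.d}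
    (a : Fin S.nwk → ℝ) {ξ : Patch S.d} (hξ : S.IsNoise ξ) :
    inner ℝ (∑ j, a j • labelSign (train j).2 • patchSum (train j).1) ξ =
      inner ℝ (noiseSum train a) ξ := by
  unfold noiseSum
  rw [sum_inner, sum_inner]
  refine Finset.sum_congr rfl fun j _ => ?_
  rw [patchSum_eq (train j)]
  simp only [real_inner_smul_left, inner_add_left, (hξ _).1, (hξ _).2]
  ring

/-- On a good training set, the test error bound holds at all admissible times. -/
lemma GoodTraining.condTestError_le {C : ℝ} {train : Fin S.nwk → DataPoint S.d}
    (g : S.GoodTraining (S.crossBound C) train) (h : S.DataScarce C) (hC : 10 ^ 8 ≤ C) {t : ℕ}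
    (ht : (t : ℝ) ≤ S.Tstar) :
    S.condTestError (weakIterate S.η train t) ≤
      ENNReal.ofReal (S.errorBound (640 * 14400 ^ 2)) := by
  -- At time 0 there is no positive margin, but the model vanishes identically and the strict
  -- inequality `y f < 0` never holds.
  rcases Nat.eq_zero_or_pos t with rfl | ht0
  · rw [weakIterate, IsAdmissible.condTestError_zero]
    exact zero_le
  · obtain ⟨m, hm, hmargin, V, -, hV, hexp⟩ := g.signal_to_noise h hC ht0 ht
    refine (h.condTestError_le hm.le hmargin (fun ξ hξ => ?_) hV).trans
      (ENNReal.ofReal_le_ofReal hexp)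
    rw [weakIterate_eq_sum]
    exact inner_sum_eq_noiseSum _ hξ

end Setting

/-! ### Probability of a good training set. -/

namespace Setting

variable {S : Setting} {C : ℝ}

namespace DataScarce

lemma trainingLaw_eval (h : S.DataScarce C) (i : Fin S.nwk) {A : Set (DataPoint S.d)}
    (hA : MeasurableSet A) : S.trainingLaw {train | train i ∈ A} = S.dataLaw A := by
  have := h.isProbabilityMeasure_dataLaw
  exact (measurePreserving_eval (fun _ : Fin S.nwk => S.dataLaw) i).measure_preimage
    hA.nullMeasurableSet

lemma trainingLaw_noise (h : S.DataScarce C) (i : Fin S.nwk) {A : Set (Patch S.d)}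
    (hA : MeasurableSet A) :
    S.trainingLaw {train | S.noisePart (train i) ∈ A} = S.noiseLaw A := by
  rw [← h.map_noisePart, Measure.map_apply measurable_noisePart hA]
  exact h.trainingLaw_eval i (measurable_noisePart hA)

lemma trainingLaw_noise_pair (h : S.DataScarce C) {i j : Fin S.nwk} (hij : i ≠ j)
    {A : Set (Patch S.d × Patch S.d)} (hA : MeasurableSet A) :
    S.trainingLaw {train | (S.noisePart (train i), S.noisePart (train j)) ∈ A} =
      (S.noiseLaw.prod S.noiseLaw) A := by
  have := h.isProbabilityMeasure_dataLaw
  have hind := iIndepFun_pi (μ := fun _ : Fin S.nwk => S.dataLaw) (X := fun _ => S.noisePart)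
    (fun _ => measurable_noisePart.aemeasurable)
  have hm : ∀ i : Fin S.nwk, Measurable fun train : Fin S.nwk → DataPoint S.d =>
    S.noisePart (train i) := fun i => measurable_noisePart.comp (measurable_pi_apply i)
  have hp := (indepFun_iff_map_prod_eq_prod_map_map (hm i).aemeasurable
    (hm j).aemeasurable).1 (hind.indepFun hij)
  have hlaw : ∀ i : Fin S.nwk, (Measure.pi fun _ : Fin S.nwk => S.dataLaw).map
      (fun train => S.noisePart (train i)) = S.noiseLaw := by
    intro i
    ext B hB
    rw [Measure.map_apply (hm i) hB]
    exact h.trainingLaw_noise i hB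
  rw [hlaw, hlaw] at hp
  rw [← hp, Measure.map_apply ((hm i).prodMk (hm j)) hA]
  rfl

lemma exp_neg_logFactor_le (h : S.DataScarce C) (hC : 10 ^ 8 ≤ C) :
    Real.exp (-S.logFactor C) = S.δ / (C * S.nwk ^ 2) := by
  have h1 := h.one_le_nwk hC
  have h2 := h.δ_pos
  rw [logFactor, Real.exp_neg, Real.exp_log (by positivity), inv_div]

lemma trainingLaw_norm_bad (h : S.DataScarce C) (hC : 10 ^ 8 ≤ C) (i : Fin S.nwk) :
    S.trainingLaw {train | ‖S.noisePart (train i)‖ ^ 2 < S.σp ^ 2 * S.d / 5 ∨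
      4 * (S.σp ^ 2 * S.d) < ‖S.noisePart (train i)‖ ^ 2} ≤
      ENNReal.ofReal (10 * (S.δ / (C * S.nwk ^ 2))) := by
  have m1 : MeasurableSet {ξ : Patch S.d | ‖ξ‖ ^ 2 < S.σp ^ 2 * S.d / 5} :=
    measurableSet_lt (by fun_prop) measurable_const
  have m2 : MeasurableSet {ξ : Patch S.d | 4 * (S.σp ^ 2 * S.d) < ‖ξ‖ ^ 2} :=
    measurableSet_lt measurable_const (by fun_prop)
  have hL := h.logFactor_pos hC
  have hd : S.logFactor C ≤ (S.d : ℝ) / 160 := by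
    have h1 := h.dim_ge hC
    have h2 := h.log_Tstar_ge
    have h3 : 160 ≤ C * S.nwk ^ 2 * Real.log S.Tstar ^ 2 := by
      calc (160 : ℝ) ≤ 10 ^ 8 * 1 ^ 2 * 0.69 ^ 2 := by norm_num
        _ ≤ _ := by gcongr; exact h.one_le_nwk hC
    have h4 := mul_le_mul_of_nonneg_right h3 hL.le
    linarith
  have he : Real.exp (-((S.d : ℝ) / 160)) ≤ S.δ / (C * S.nwk ^ 2) := by
    rw [← h.exp_neg_logFactor_le hC, Real.exp_le_exp]
    linarith
  calc _ ≤ S.noiseLaw ({ξ | ‖ξ‖ ^ 2 < S.σp ^ 2 * S.d / 5} ∪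
        {ξ | 4 * (S.σp ^ 2 * S.d) < ‖ξ‖ ^ 2}) := (h.trainingLaw_noise i (m1.union m2)).le
    _ ≤ 9 * ENNReal.ofReal (Real.exp (-((S.d : ℝ) / 160))) +
        ENNReal.ofReal (Real.exp (-((S.d : ℝ) / 160))) :=
      (measure_union_le _ _).trans (add_le_add h.noiseLaw_norm_lower h.noiseLaw_norm_upper)
    _ = 10 * ENNReal.ofReal (Real.exp (-((S.d : ℝ) / 160))) := by ring
    _ = ENNReal.ofReal (10 * Real.exp (-((S.d : ℝ) / 160))) := by
      rw [ENNReal.ofReal_mul (by norm_num)]; norm_num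
    _ ≤ _ := by gcongr

/-- Conditionally on `ξ i`, the inner product is Gaussian with variance at most `σp² ‖ξ i‖²`. The
norm bound sits inside the event to control this variance; its failure is counted separately. -/
lemma trainingLaw_cross_bad (h : S.DataScarce C) (hC : 10 ^ 8 ≤ C) {i j : Fin S.nwk}
    (hij : i ≠ j) :
    S.trainingLaw {train | ‖S.noisePart (train i)‖ ^ 2 ≤ 4 * (S.σp ^ 2 * S.d) ∧
      S.crossBound C < |inner ℝ (S.noisePart (train i)) (S.noisePart (train j))|} ≤
      ENNReal.ofReal (2 * (S.δ / (C * S.nwk ^ 2))) := by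
  have hm : MeasurableSet {p : Patch S.d × Patch S.d | ‖p.1‖ ^ 2 ≤ 4 * (S.σp ^ 2 * S.d) ∧
      S.crossBound C < |inner ℝ p.1 p.2|} := by
    have m1 : MeasurableSet {p : Patch S.d × Patch S.d | ‖p.1‖ ^ 2 ≤ 4 * (S.σp ^ 2 * S.d)} :=
      measurableSet_le (measurable_fst.norm.pow_const 2) measurable_const
    have m2 : MeasurableSet {p : Patch S.d × Patch S.d | S.crossBound C < |inner ℝ p.1 p.2|} :=
      measurableSet_lt measurable_const (measurable_fst.inner measurable_snd).abs
    exact m1.inter m2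
  have hL := h.logFactor_pos hC
  have hD := h.noiseScale_pos hC
  have hσ := h.σp_pos
  have hd := h.dim_pos hC
  refine (h.trainingLaw_noise_pair hij hm).le.trans ?_
  rw [Measure.prod_apply hm]
  have hexp : Real.exp (-(S.crossBound C ^ 2 / (2 * (S.σp ^ 2 * (4 * (S.σp ^ 2 * S.d)))))) ≤
      S.δ / (C * S.nwk ^ 2) := by
    rw [← h.exp_neg_logFactor_le hC, Real.exp_le_exp]
    -- The factor 4 in `crossBound` gives `16 / 8 = 2` times `logFactor`, more than the one multiple
    -- needed for a union over `n²` pairs.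
    have : S.crossBound C ^ 2 / (2 * (S.σp ^ 2 * (4 * (S.σp ^ 2 * S.d)))) =
        2 * S.logFactor C := by
      rw [crossBound, mul_pow, Real.sq_sqrt (by positivity)]
      field_simp
      norm_num
    linarith
  have slice : ∀ ξ : Patch S.d, S.noiseLaw (Prod.mk ξ ⁻¹' {p : Patch S.d × Patch S.d |
      ‖p.1‖ ^ 2 ≤ 4 * (S.σp ^ 2 * S.d) ∧ S.crossBound C < |inner ℝ p.1 p.2|}) ≤
      ENNReal.ofReal (2 * (S.δ / (C * S.nwk ^ 2))) := by
    intro ξ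
    by_cases hξ : ‖ξ‖ ^ 2 ≤ 4 * (S.σp ^ 2 * S.d)
    · refine (measure_mono fun ξ' hξ' => ?_).trans
        ((h.noiseLaw_abs_inner_ge_le (r := S.crossBound C) ξ hξ crossBound_nonneg).trans ?_)
      · exact hξ'.2.le
      · rw [ENNReal.ofReal_mul (by norm_num)]
        gcongr
        norm_num
    · have : Prod.mk ξ ⁻¹' {p : Patch S.d × Patch S.d | ‖p.1‖ ^ 2 ≤ 4 * (S.σp ^ 2 * S.d) ∧
          S.crossBound C < |inner ℝ p.1 p.2|} = ∅ := by
        ext ξ'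
        simp [hξ]
      rw [this, measure_empty]
      exact zero_le
  refine (lintegral_mono slice).trans ?_
  rw [lintegral_const, measure_univ, mul_one]

lemma exp_hoeffding_le (h : S.DataScarce C) (hC : 10 ^ 8 ≤ C) {p τ : ℝ} (hp : 0 < p)
    (hpτ : p / 4 ≤ τ)
    (hmax : (p ^ 2)⁻¹ ≤ max (max (S.pe ^ 2)⁻¹ (S.pb ^ 2)⁻¹) (S.ph ^ 2)⁻¹) :
    Real.exp (-(S.nwk * τ ^ 2 / 2)) ≤ S.δ / C := by
  have hδ := h.δ_pos
  have hlog := h.log_div_pos hC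
  have h1 : C * (p ^ 2)⁻¹ * Real.log (C / S.δ) ≤ S.nwk := by
    refine le_trans ?_ h.nwk_large
    gcongr
  have h2 : C * Real.log (C / S.δ) ≤ S.nwk * p ^ 2 := by
    have := mul_le_mul_of_nonneg_right h1 (sq_nonneg p)
    have e : C * (p ^ 2)⁻¹ * Real.log (C / S.δ) * p ^ 2 = C * Real.log (C / S.δ) := by
      field_simp
    linarith
  have h3 : S.nwk * (p / 4) ^ 2 ≤ S.nwk * τ ^ 2 := by gcongr
  have h4 : 32 * Real.log (C / S.δ) ≤ C * Real.log (C / S.δ) := by gcongr; linarith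
  have h5 : S.δ / C = Real.exp (-Real.log (C / S.δ)) := by
    rw [Real.exp_neg, Real.exp_log (by positivity), inv_div]
  rw [h5, Real.exp_le_exp]
  linarith

lemma trainingLaw_counts_bad (h : S.DataScarce C) (hC : 10 ^ 8 ≤ C) :
    S.trainingLaw {train | ¬ (∑ i, S.easyCoeff (train i) ≤ S.nwk * (2 * (2 * S.pe + S.pb)))} ≤
      ENNReal.ofReal (S.δ / C) ∧
    S.trainingLaw {train | ¬ (∑ i, |S.hardCoeff (train i)| ≤ S.nwk * (3 * S.pb))} ≤
      ENNReal.ofReal (S.δ / C) ∧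
    ∀ y, S.trainingLaw {train | ¬ (S.nwk * ((2 * S.pe + S.pb) / 4) ≤
      ∑ i, if (train i).2 = y then S.easyCoeff (train i) else 0)} ≤
      ENNReal.ofReal (S.δ / C) := by
  have := h.isProbabilityMeasure_dataLaw
  have hpe := h.pe_pos
  have hpb := h.pb_pos
  have hph := h.ph_pos
  have hn := h.one_le_nwk hC
  have me : (S.pe ^ 2)⁻¹ ≤ max (max (S.pe ^ 2)⁻¹ (S.pb ^ 2)⁻¹) (S.ph ^ 2)⁻¹ :=
    (le_max_left _ _).trans (le_max_left _ _)
  have mb : (S.pb ^ 2)⁻¹ ≤ max (max (S.pe ^ 2)⁻¹ (S.pb ^ 2)⁻¹) (S.ph ^ 2)⁻¹ :=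
    (le_max_right _ _).trans (le_max_left _ _)
  refine ⟨?_, ?_, fun y => ?_⟩
  · have key := hoeffding_pi S.dataLaw S.nwk (φ := S.easyCoeff) (τ := 2 * S.pe + S.pb)
      measurable_easyCoeff
      (h.ae_isRegular.mono fun z hz => ⟨hz.easyCoeff_nonneg, hz.easyCoeff_le⟩) (by linarith)
    rw [h.integral_easyCoeff] at key
    refine (measure_mono fun train ht => ?_).trans (key.trans
      (ENNReal.ofReal_le_ofReal (h.exp_hoeffding_le hC hpe (by linarith) me)))
    simp only [Set.mem_ofPred_eq, not_le] at ht ⊢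
    linarith
  -- The mean is `ph + pb`; with the deviation `pb` and `ph ≤ pb` the total stays below `3 pb`.
  · have key := hoeffding_pi S.dataLaw S.nwk (φ := fun z => |S.hardCoeff z|) (τ := S.pb)
      measurable_hardCoeff.abs
      (h.ae_isRegular.mono fun z hz => ⟨abs_nonneg _, hz.abs_hardCoeff_le⟩) hpb.le
    rw [h.integral_abs_hardCoeff] at key
    refine (measure_mono fun train ht => ?_).trans (key.trans
      (ENNReal.ofReal_le_ofReal (h.exp_hoeffding_le hC hpb (by linarith) mb)))
    simp only [Set.mem_ofPred_eq, not_le] at ht ⊢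
    refine le_trans ?_ ht.le
    have h1 := h.ph_le hC
    have h2 := mul_le_mul_of_nonneg_right hC hph.le
    gcongr
    linarith
  · have key := hoeffding_pi_lower S.dataLaw S.nwk (τ := (2 * S.pe + S.pb) / 4)
      (φ := fun z => if z.2 = y then S.easyCoeff z else 0)
      (IsAdmissible.measurable_labelled_easyCoeff y)
      (h.ae_isRegular.mono fun z hz => by
        split_ifs
        · exact ⟨hz.easyCoeff_nonneg, hz.easyCoeff_le⟩
        · norm_num) (by linarith)
    rw [h.integral_labelled_easyCoeff] at key
    refine (measure_mono fun train ht => ?_).trans (key.trans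
      (ENNReal.ofReal_le_ofReal (h.exp_hoeffding_le hC hpe (by linarith) me)))
    simp only [Set.mem_ofPred_eq, not_le] at ht ⊢
    linarith

lemma trainingLaw_not_good (h : S.DataScarce C) (hC : 10 ^ 8 ≤ C) :
    S.trainingLaw {train | ¬ S.GoodTraining (S.crossBound C) train} ≤ ENNReal.ofReal S.δ := by
  have := h.isProbabilityMeasure_dataLaw
  have hδ := h.δ_pos
  have hn := h.one_le_nwk hC
  have hC0 : (0 : ℝ) < C := by linarith
  obtain ⟨b1, b2, b3⟩ := h.trainingLaw_counts_bad hC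
  set R := {train : Fin S.nwk → DataPoint S.d | ¬ ∀ i, S.IsRegular (train i)} with hR
  set B1 := {train : Fin S.nwk → DataPoint S.d |
    ¬ (∑ i, S.easyCoeff (train i) ≤ S.nwk * (2 * (2 * S.pe + S.pb)))}
  set B2 := {train : Fin S.nwk → DataPoint S.d |
    ¬ (∑ i, |S.hardCoeff (train i)| ≤ S.nwk * (3 * S.pb))}
  set B3 : ℤˣ → Set (Fin S.nwk → DataPoint S.d) := fun y =>
    {train | ¬ (S.nwk * ((2 * S.pe + S.pb) / 4) ≤
      ∑ i, if (train i).2 = y then S.easyCoeff (train i) else 0)}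
  set B4 : Fin S.nwk → Set (Fin S.nwk → DataPoint S.d) := fun i =>
    {train | ‖S.noisePart (train i)‖ ^ 2 < S.σp ^ 2 * S.d / 5 ∨
      4 * (S.σp ^ 2 * S.d) < ‖S.noisePart (train i)‖ ^ 2}
  set B5 : Fin S.nwk → Fin S.nwk → Set (Fin S.nwk → DataPoint S.d) := fun i j =>
    {train | i ≠ j ∧ (‖S.noisePart (train i)‖ ^ 2 ≤ 4 * (S.σp ^ 2 * S.d) ∧
      S.crossBound C < |inner ℝ (S.noisePart (train i)) (S.noisePart (train j))|)}
  have cover : {train | ¬ S.GoodTraining (S.crossBound C) train} ⊆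
      R ∪ (B1 ∪ (B2 ∪ ((⋃ y, B3 y) ∪ ((⋃ i, B4 i) ∪ (⋃ i, ⋃ j, B5 i j))))) := by
    intro train hbad
    by_contra hcon
    simp only [Set.mem_union, Set.mem_iUnion, not_or, not_exists] at hcon
    obtain ⟨c0, c1, c2, c3, c4, c5⟩ := hcon
    have c4' : ∀ i, ¬ (‖S.noisePart (train i)‖ ^ 2 < S.σp ^ 2 * S.d / 5 ∨
      4 * (S.σp ^ 2 * S.d) < ‖S.noisePart (train i)‖ ^ 2) := c4
    refine hbad ⟨not_not.1 c0, fun i => not_lt.1 (not_or.1 (c4' i)).1,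
      fun i => not_lt.1 (not_or.1 (c4' i)).2, fun i j hij => ?_, not_not.1 c1,
      fun y => not_not.1 (c3 y), not_not.1 c2⟩
    by_contra hlt
    exact c5 i j ⟨hij, not_lt.1 (not_or.1 (c4' i)).2, not_le.1 hlt⟩
  have r0 : S.trainingLaw R = 0 := by
    have : ∀ᵐ train ∂S.trainingLaw, ∀ i, S.IsRegular (train i) := by
      rw [ae_all_iff]
      intro i
      have e := h.trainingLaw_eval i measurableSet_isRegular.compl
      have e' : S.dataLaw {z | S.IsRegular z}ᶜ = 0 := h.ae_isRegular
      rw [e'] at e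
      exact e
    exact this
  have u3 : S.trainingLaw (⋃ y, B3 y) ≤ ENNReal.ofReal (2 * (S.δ / C)) := by
    refine (measure_iUnion_fintype_le _ _).trans
      ((Finset.sum_le_sum fun y _ => b3 y).trans (le_of_eq ?_))
    rw [ENNReal.ofReal_mul (by norm_num)]
    simp
  have u4 : S.trainingLaw (⋃ i, B4 i) ≤ ENNReal.ofReal (10 * (S.δ / C)) := by
    refine (measure_iUnion_fintype_le _ _).trans
      ((Finset.sum_le_sum fun i _ => h.trainingLaw_norm_bad hC i).trans ?_)
    rw [Finset.sum_const, Finset.card_univ, Fintype.card_fin, nsmul_eq_mul,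
      ← ENNReal.ofReal_natCast, ← ENNReal.ofReal_mul (by positivity)]
    apply ENNReal.ofReal_le_ofReal
    have : S.nwk * (10 * (S.δ / (C * S.nwk ^ 2))) = 10 * (S.δ / C) / S.nwk := by
      field_simp
    rw [this]
    exact div_le_self (by positivity) hn
  have u5 : S.trainingLaw (⋃ i, ⋃ j, B5 i j) ≤ ENNReal.ofReal (2 * (S.δ / C)) := by
    have each : ∀ i j, S.trainingLaw (B5 i j) ≤
        ENNReal.ofReal (2 * (S.δ / (C * S.nwk ^ 2))) := by
      intro i j
      by_cases hij : i = j
      · have : B5 i j = ∅ := by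
          ext train
          simp [B5, hij]
        rw [this, measure_empty]
        exact zero_le
      · exact (measure_mono fun train ht => ht.2).trans (h.trainingLaw_cross_bad hC hij)
    refine (measure_iUnion_fintype_le _ _).trans ((Finset.sum_le_sum fun i _ =>
      (measure_iUnion_fintype_le _ _).trans (Finset.sum_le_sum fun j _ => each i j)).trans
        (le_of_eq ?_))
    simp only [Finset.sum_const, Finset.card_univ, Fintype.card_fin, nsmul_eq_mul]
    rw [← ENNReal.ofReal_natCast, ← ENNReal.ofReal_mul (by positivity),
      ← ENNReal.ofReal_mul (by positivity)]
    congr 1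
    field_simp
  have hx : 0 ≤ S.δ / C := by positivity
  calc _ ≤ S.trainingLaw R + (S.trainingLaw B1 + (S.trainingLaw B2 + (S.trainingLaw (⋃ y, B3 y) +
        (S.trainingLaw (⋃ i, B4 i) + S.trainingLaw (⋃ i, ⋃ j, B5 i j))))) := by
        refine (measure_mono cover).trans ?_
        refine (measure_union_le _ _).trans (add_le_add le_rfl ?_)
        refine (measure_union_le _ _).trans (add_le_add le_rfl ?_)
        refine (measure_union_le _ _).trans (add_le_add le_rfl ?_)
        refine (measure_union_le _ _).trans (add_le_add le_rfl ?_)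
        exact measure_union_le _ _
    _ ≤ 0 + (ENNReal.ofReal (S.δ / C) + (ENNReal.ofReal (S.δ / C) +
        (ENNReal.ofReal (2 * (S.δ / C)) + (ENNReal.ofReal (10 * (S.δ / C)) +
          ENNReal.ofReal (2 * (S.δ / C)))))) := by
        rw [r0]; gcongr
    -- `16 = 1 + 1 + 2 + 10 + 2`: the two totals, the two labels, the norms and the pairs.
    _ = ENNReal.ofReal (16 * (S.δ / C)) := by
        rw [zero_add, ← ENNReal.ofReal_add (by positivity) (by positivity),
          ← ENNReal.ofReal_add (by positivity) (by positivity),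
          ← ENNReal.ofReal_add (by positivity) (by positivity),
          ← ENNReal.ofReal_add (by positivity) (by positivity)]
        congr 1
        ring
    _ ≤ ENNReal.ofReal S.δ := by
        apply ENNReal.ofReal_le_ofReal
        rw [mul_div_assoc', div_le_iff₀ hC0]
        have := mul_le_mul_of_nonneg_left hC hδ.le
        linarith

end DataScarce

/-! ### Vanishing of the error bound, and the theorem. -/

lemma tendsto_errorBound {ι : Type*} {l : Filter ι} {S : ι → Setting} {C₁ : ℝ} (hC₁ : 0 < C₁)
    (hC : 10 ^ 8 ≤ C) (hS : ∀ᶠ i in l, (S i).DataScarce C)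
    (ho : (fun i => (S i).sampleScale) =o[l] (fun i => ((S i).nwk : ℝ))) :
    Tendsto (fun i => (S i).errorBound C₁) l (𝓝 0) := by
  unfold errorBound
  refine Real.tendsto_exp_neg_atTop_nhds_zero.comp ?_
  rw [tendsto_atTop]
  intro M
  -- With this little-o constant the exponent is at least `|M| + 1`.
  have hM : 0 < 1 / (C₁ * (|M| + 1)) := by positivity
  filter_upwards [hS, ho.bound hM] with i hi hb
  have hD := hi.dim_pos hC
  have hσ := hi.σp_pos
  have hμ := hi.normμ_pos
  have hP := hi.easyMass_pos
  have hs : 0 < (S i).sampleScale := by unfold sampleScale; positivity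
  rw [Real.norm_of_nonneg hs.le, Real.norm_of_nonneg (Nat.cast_nonneg _), one_div_mul_eq_div,
    le_div_iff₀ (by positivity)] at hb
  have e : ((S i).nwk : ℝ) * (2 * (S i).pe + (S i).pb) ^ 2 * (S i).normμ ^ 4 /
      (C₁ * (S i).σp ^ 4 * ((S i).d : ℝ)) = (S i).nwk / (C₁ * (S i).sampleScale) := by
    unfold sampleScale; field_simp
  rw [e, le_div_iff₀ (by positivity)]
  have h1 := mul_le_mul_of_nonneg_right (le_abs_self M)
    (show 0 ≤ C₁ * (S i).sampleScale by positivity)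
  have h2 : 0 < C₁ * (S i).sampleScale := by positivity
  linarith

end Setting

theorem theorem1 :
    ∃ C₀ > (0 : ℝ), ∃ C₁ > (0 : ℝ), ∃ K > (0 : ℝ), ∃ k : ℕ, ∀ C ≥ C₀,
      (∀ S : Setting, S.DataScarce C →
        ENNReal.ofReal (1 - S.δ) ≤ S.trainingLaw
          {train | ∃ Twk : ℕ, (Twk : ℝ) ≤ S.timeBound K k ∧
            ∀ t : ℕ, Twk ≤ t → (t : ℝ) ≤ S.Tstar →
              trainingLoss train (weakIterate S.η train t) < S.ε ∧
              S.condTestError (weakIterate S.η train t) ≤ ENNReal.ofReal (S.errorBound C₁)}) ∧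
      (∀ (ι : Type) (l : Filter ι) (S : ι → Setting),
        (∀ᶠ i in l, (S i).DataScarce C) →
        (fun i => (S i).sampleScale) =o[l] (fun i => ((S i).nwk : ℝ)) →
        Tendsto (fun i => (S i).errorBound C₁) l (𝓝 0)) := by
  -- The time bound holds without logarithmic factors, hence `k = 0`.
  refine ⟨10 ^ 8, by norm_num, 640 * 14400 ^ 2, by norm_num, 100, by norm_num, 0,
    fun C hC => ⟨fun S h => ?_, fun ι l S hS ho =>
      Setting.tendsto_errorBound (by norm_num) hC hS ho⟩⟩
  have := h.isProbabilityMeasure_dataLaw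
  have : IsProbabilityMeasure S.trainingLaw := by unfold Setting.trainingLaw; infer_instance
  have hB : 0 ≤ S.timeBound 100 0 := by
    have := h.η_pos
    have := h.ε_pos
    unfold Setting.timeBound
    positivity
  set G := {train : Fin S.nwk → DataPoint S.d | S.GoodTraining (S.crossBound C) train} with hG
  have hcompl : S.trainingLaw Gᶜ ≤ ENNReal.ofReal S.δ := h.trainingLaw_not_good hC
  have hlow : ENNReal.ofReal (1 - S.δ) ≤ S.trainingLaw G := by
    rw [ENNReal.ofReal_sub _ h.δ_pos.le, ENNReal.ofReal_one, tsub_le_iff_right]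
    calc (1 : ℝ≥0∞) = S.trainingLaw (G ∪ Gᶜ) := by rw [Set.union_compl_self, measure_univ]
      _ ≤ S.trainingLaw G + S.trainingLaw Gᶜ := measure_union_le _ _
      _ ≤ _ := by gcongr
  refine hlow.trans (measure_mono fun train hg => ?_)
  have g : S.GoodTraining (S.crossBound C) train := hg
  refine ⟨⌊S.timeBound 100 0⌋₊, Nat.floor_le hB, fun t ht htT => ⟨?_, ?_⟩⟩
  · refine g.trainingLoss_lt h hC htT ((Nat.lt_floor_add_one _).trans_le ?_)
    exact_mod_cast Nat.add_le_add_right ht 1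
  · exact g.condTestError_le h hC htT
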